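/- Let $(\Omega,\mathcal F,P^0)$ be a complete probability space with expectation $E^0$. Let $X$ be an $\mathbb R^{d_1}$-valued Lévy-stable process with index $\alpha\in(0,2]$ and finite spectral measure $\Gamma$ on the unit sphere: $X_0$ and the increments of $X$ over disjoint time intervals are independent, and for $0\le s<t$, $\theta\in\mathbb R^{d_1}$, $$E^0\{e^{i\theta'(X_t-X_s)}\}=e^{-(t-s)\psi(\theta)},$$ where $$\psi(\theta)=\begin{cases}\int|\theta'z|^\alpha\bigl(1-i\,\mathrm{sign}(\theta'z)\tan\tfrac{\alpha\pi}2\bigr)\Gamma(dz),&\alpha\ne1,\\ \int|\theta'z|\bigl(1+\tfrac{2i}\pi\,\mathrm{sign}(\theta'z)\ln|\theta'z|\bigr)\Gamma(dz),&\alpha=1.\end{cases}$$ Let $V$ be a standard $\mathbb R^{d_2}$-valued Brownian motion independent of $X$, let $h:\mathbb R^{d_1}\to\mathbb R^{d_2}$ have Schwartz components, let $0<\varepsilon\le1$, $t_k=k\varepsilon$, $Y_0=0$ and $Y_{t_k}=Y_{t_{k-1}}+h(X_{t_k})\varepsilon+(V_{t_k}-V_{t_{k-1}})$ for $k\ge1$.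 Let $\mathcal Y^t$ be the $\sigma$-field generated by $\{Y_{t_k}:t_k\le t\}$ and the $P^0$-null sets. Put $$\eta_t=\prod_{k=1}^{\lfloor t/\varepsilon\rfloor}\exp\Bigl\{-h'(X_{t_k})(V_{t_k}-V_{t_{k-1}})-\tfrac{\varepsilon}{2}(h'h)(X_{t_k})\Bigr\},$$ and, for $T\ge0$, let $E$ be the expectation under the measure $P$ given by $dP/dP^0=\eta_T$. For $\lambda$ a finite Borel measure on $\mathbb R^{d_1}$ write $\langle\lambda,\varphi\rangle=\int\varphi\,d\lambda$. Let $\mathcal L$ be the generator of $X$, defined by $\mathcal L\varphi(x)=\lim_{t\downarrow0}\frac{E^0\varphi(x+X_t-X_0)-\varphi(x)}{t}$ (convergence pointwise in $x$, with the difference quotients bounded uniformly in $x$ and $t>0$), and let $\mathcal T$ be the set of bounded measurable $\varphi:\mathbb R^{d_1}\to\mathbb C$ for which $\mathcal L\varphi$ exists and is bounded and measurable. **Lemma 1.** (a) The unnormalized filter exists: there is a process $\{\mu_t,\,t\ge0\}$ of finite measures on $\mathbb R^{d_1}$ with weakly càdlàg paths such that for all $T\ge 0$, all $t\le T$ and all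 bounded measurable $\varphi$, $\langle\mu_t,\varphi\rangle=E\{\varphi(X_t)\eta_t^{-1}\mid\mathcal Y^t\}$ a.s. (b) Let $T\ge0$ and let $\{\mu_t,\,0\le t\le T\}$ be any process of finite measures with weakly càdlàg paths that satisfies the last identity for this $T$, all $t\le T$ and all bounded measurable $\varphi$. Then $\{\mu_t\}$ is $\{\mathcal Y^t\}$-progressive on $[0,T]$, its left limits and the integral below exist, and, with $\mu_0$ on the right-hand side the distribution of $X_0$, for every $\varphi\in\mathcal T$, almost surely for all $t\le T$, $$\langle\mu_t,\varphi\rangle=\langle\mu_0,\varphi\rangle+\int_0^t\langle\mu_s,\mathcal L\varphi\rangle\,ds+\sum_{k=1}^{\lfloor t/\varepsilon\rfloor}\Bigl\langle\mu_{t_k-},\,\varphi\Bigl(\exp\Bigl\{(Y_{t_k}-Y_{t_{k-1}})'h-\tfrac{\varepsilon}{2}h'h\Bigr\}-1\Bigr)\Bigr\rangle .\qquad(4)$$ (c) It is the unique such process: if $\{\nu_t,\,0\le t\le T\}$ is any $\{\mathcal Y^t\}$-progressive process of finite measures that almost surely has weak left limits at the times $t_k\le T$, $k\ge1$, and satisfies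 (4) (with $\nu$ in place of $\mu$, and $\mu_0$ still the distribution of $X_0$) in the same sense, then almost surely $\nu_t=\mu_t$ for all $t\le T$. -/

import Mathlib

open MeasureTheory ProbabilityTheory Filter Topology Set
open scoped NNReal ENNReal RealInnerProductSpace SchwartzMap

noncomputable section

namespace ContinuousDiscreteFilter

/-- The Euclidean space `ℝ^d`. -/
abbrev Euc (d : ℕ) : Type := EuclideanSpace ℝ (Fin d)

variable {Ω : Type*} [mΩ : MeasurableSpace Ω] {d₁ d₂ : ℕ}

/-! ### The signal, the noise and the observations -/

/-- The exponent `ψ` of the stable law with index `α` and spectral measure `Γ` on the unit sphere: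
the increment over a time span `r` has characteristic function `exp (-r ψ(θ))`. -/
def stableExponent (α : ℝ) (Γ : Measure (Metric.sphere (0 : Euc d₁) 1)) (θ : Euc d₁) : ℂ :=
  if α = 1 then
    ∫ z, ((|⟪θ, (z : Euc d₁)⟫| : ℝ) : ℂ) *
      (1 + (2 * Complex.I / Real.pi) * (Real.sign ⟪θ, (z : Euc d₁)⟫ : ℝ) *
        (Real.log |⟪θ, (z : Euc d₁)⟫| : ℝ)) ∂Γ
  else
    ∫ z, ((|⟪θ, (z : Euc d₁)⟫| ^ α : ℝ) : ℂ) *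
      (1 - Complex.I * (Real.sign ⟪θ, (z : Euc d₁)⟫ : ℝ) *
        (Real.tan (α * Real.pi / 2) : ℝ)) ∂Γ

/-- `X` is a Lévy-stable process with index `α` and spectral measure `Γ`, started from an arbitrary
random state `X 0`: the initial state and the increments over disjoint time intervals are
independent, and the increments have the stable characteristic function. -/
structure IsLevyStable (P : Measure Ω) (α : ℝ) (Γ : Measure (Metric.sphere (0 : Euc d₁) 1))
    (X : ℝ≥0 → Ω → Euc d₁) : Prop where
  measurable : ∀ t, Measurable (X t)
  indep_increments : HasIndepIncrements X P
  indep_initial : IndepFun (X 0) (fun ω (t : ℝ≥0) => X t ω - X 0 ω) P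
  charFun_increment : ∀ (s t : ℝ≥0), s < t → ∀ θ : Euc d₁,
    ∫ ω, Complex.exp (Complex.I * (⟪θ, X t ω - X s ω⟫ : ℝ)) ∂P =
      Complex.exp (-((t : ℂ) - (s : ℂ)) * stableExponent α Γ θ)

/-- `V` is a standard `ℝ^{d₂}`-valued Brownian motion: its coordinates are independent standard
real Brownian motions. -/
structure IsStandardBrownian (P : Measure Ω) (V : ℝ≥0 → Ω → Euc d₂) : Prop where
  measurable : ∀ t, Measurable (V t)
  coord : ∀ i, IsBrownianReal (fun t ω => V t ω i) P
  indep : iIndepFun (fun (i : Fin d₂) ω (t : ℝ≥0) => V t ω i) P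

/-- The observation time `t_k = k ε`. -/
def obsTime (ε : ℝ≥0) (k : ℕ) : ℝ≥0 := k * ε

/-- The observations `Y_{t_k}`, `k = 0, 1, 2, …`, started from `Y_0 = 0`. -/
def obs (X : ℝ≥0 → Ω → Euc d₁) (V : ℝ≥0 → Ω → Euc d₂) (h : 𝓢(Euc d₁, Euc d₂)) (ε : ℝ≥0) :
    ℕ → Ω → Euc d₂
  | 0 => fun _ => 0
  | k + 1 => fun ω => obs X V h ε k ω + (ε : ℝ) • h (X (obsTime ε (k + 1)) ω) +
      (V (obsTime ε (k + 1)) ω - V (obsTime ε k) ω)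

lemma measurable_obs {X : ℝ≥0 → Ω → Euc d₁} {V : ℝ≥0 → Ω → Euc d₂} (h : 𝓢(Euc d₁, Euc d₂))
    (ε : ℝ≥0) (hX : ∀ t, Measurable (X t)) (hV : ∀ t, Measurable (V t)) (k : ℕ) :
    Measurable (obs X V h ε k) := by
  induction k with
  | zero => exact measurable_const
  | succ k ih =>
    have h1 : Measurable (fun ω => h (X (obsTime ε (k + 1)) ω)) :=
      h.continuous.measurable.comp (hX _)
    exact (ih.add (h1.const_smul (ε : ℝ))).add ((hV _).sub (hV _))

/-- The observation filtration `𝒴^t = σ{Y_{t_k}, t_k ≤ t} ∨ 𝒩`, with `𝒩` the null sets of `P₀`. -/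
def obsFiltration (P₀ : Measure Ω) [P₀.IsComplete] (ε : ℝ≥0) (Y : ℕ → Ω → Euc d₂)
    (hY : ∀ k, Measurable (Y k)) : Filtration ℝ≥0 mΩ where
  seq t := (⨆ (k : ℕ) (_ : obsTime ε k ≤ t), MeasurableSpace.comap (Y k) inferInstance) ⊔
    MeasurableSpace.generateFrom {N : Set Ω | P₀ N = 0}
  mono' := by
    intro s t hst
    refine sup_le_sup_right ?_ _
    exact iSup_mono fun k => iSup_mono' fun hk => ⟨hk.trans hst, le_rfl⟩
  le' := by
    intro t
    refine sup_le (iSup₂_le fun k _ => (hY k).comap_le) ?_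
    exact MeasurableSpace.generateFrom_le fun N hN => measurableSet_of_null hN

/-! ### The change of measure -/

/-- The density `η_t = ∏_{t_k ≤ t} exp (-h'(X_{t_k}) (V_{t_k} - V_{t_{k-1}}) - (h'h)(X_{t_k}) ε/2)`. -/
def density (X : ℝ≥0 → Ω → Euc d₁) (V : ℝ≥0 → Ω → Euc d₂) (h : 𝓢(Euc d₁, Euc d₂)) (ε : ℝ≥0)
    (t : ℝ≥0) (ω : Ω) : ℝ :=
  ∏ k ∈ Finset.Icc 1 ⌊t / ε⌋₊,
    Real.exp (-⟪h (X (obsTime ε k) ω), V (obsTime ε k) ω - V (obsTime ε (k - 1)) ω⟫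
      - ‖h (X (obsTime ε k) ω)‖ ^ 2 * ε / 2)

/-- The reference measure `P` on the horizon `[0, T]`, with `dP/dP₀ = η_T`. -/
def refMeasure (P₀ : Measure Ω) (X : ℝ≥0 → Ω → Euc d₁) (V : ℝ≥0 → Ω → Euc d₂)
    (h : 𝓢(Euc d₁, Euc d₂)) (ε T : ℝ≥0) : Measure Ω :=
  P₀.withDensity fun ω => ENNReal.ofReal (density X V h ε T ω)

/-! ### Test functions and the generator of the signal -/

/-- Bounded measurable (complex-valued) functions. -/
def IsBoundedMeasurable (φ : Euc d₁ → ℂ) : Prop :=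
  Measurable φ ∧ ∃ C : ℝ, ∀ x, ‖φ x‖ ≤ C

/-- The transition semigroup of the signal, `(S_t φ)(x) = E⁰[φ(x + X_t - X_0)]`. -/
def semigroup (P₀ : Measure Ω) (X : ℝ≥0 → Ω → Euc d₁) (t : ℝ≥0) (φ : Euc d₁ → ℂ)
    (x : Euc d₁) : ℂ :=
  ∫ ω, φ (x + (X t ω - X 0 ω)) ∂P₀

/-- `φ` and `ℒφ = g` are both bounded and measurable, where `ℒ` is the generator of the signal:
the difference quotients `(S_t φ - φ)/t` converge to `g` boundedly and pointwise as `t ↓ 0`. -/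
structure HasGenerator (P₀ : Measure Ω) (X : ℝ≥0 → Ω → Euc d₁) (φ g : Euc d₁ → ℂ) : Prop where
  bounded_left : IsBoundedMeasurable φ
  bounded_right : IsBoundedMeasurable g
  bounded_quotient : ∃ C : ℝ, ∀ t : ℝ≥0, 0 < t → ∀ x,
    ‖(t : ℂ)⁻¹ * (semigroup P₀ X t φ x - φ x)‖ ≤ C
  tendsto_quotient : ∀ x,
    Tendsto (fun t : ℝ≥0 => (t : ℂ)⁻¹ * (semigroup P₀ X t φ x - φ x)) (𝓝[>] 0) (𝓝 (g x))

/-! ### Measure-valued processes on `[0, T]`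

A process on `[0, T]` is represented by a process on `[0, ∞)` of which only the values at times
`t ≤ T` matter; `freeze T μ` is its extension that stays constant after `T`. -/

/-- The process frozen at time `T`. -/
def freeze {S : Type*} (T : ℝ≥0) (μ : ℝ≥0 → Ω → S) : ℝ≥0 → Ω → S :=
  fun t => μ (min t T)

/-- Right continuous with left limits. -/
def IsCadlag {S : Type*} [TopologicalSpace S] (f : ℝ≥0 → S) : Prop :=
  ∀ t, ContinuousWithinAt f (Ici t) t ∧ ∃ l, Tendsto f (𝓝[<] t) (𝓝 l)

/-- The process `(μ_t)_{t ≤ T}` of finite measures is progressive on `[0, T]`. The space of finite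
measures carries the σ-algebra generated by the evaluations on Borel sets. -/
def IsProgressiveUpTo (𝒴 : Filtration ℝ≥0 mΩ) (T : ℝ≥0)
    (μ : ℝ≥0 → Ω → FiniteMeasure (Euc d₁)) : Prop :=
  IsProgressive 𝒴 fun t ω => ((freeze T μ t ω : FiniteMeasure (Euc d₁)) : Measure (Euc d₁))

/-- `(μ_t)_{t ≤ T}` is the unnormalized filter on `[0, T]`: it is a version, càdlàg for the weak
topology, of `⟨μ_t, φ⟩ = E[φ(X_t) η_t⁻¹ | 𝒴^t]`, where `E` is the expectation under the reference
measure on `[0, T]`. -/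
structure IsUnnormalizedFilter (P₀ : Measure Ω) (X : ℝ≥0 → Ω → Euc d₁) (V : ℝ≥0 → Ω → Euc d₂)
    (h : 𝓢(Euc d₁, Euc d₂)) (ε : ℝ≥0) (𝒴 : Filtration ℝ≥0 mΩ) (T : ℝ≥0)
    (μ : ℝ≥0 → Ω → FiniteMeasure (Euc d₁)) : Prop where
  cadlag : ∀ ω, IsCadlag fun t => freeze T μ t ω
  condExp : ∀ t, t ≤ T → ∀ φ : Euc d₁ → ℂ, IsBoundedMeasurable φ →
    (fun ω => ∫ x, φ x ∂(μ t ω : Measure (Euc d₁))) =ᵐ[refMeasure P₀ X V h ε T]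
      (refMeasure P₀ X V h ε T)[fun ω => φ (X t ω) * (((density X V h ε t ω)⁻¹ : ℝ) : ℂ) | 𝒴 t]

/-- `(μ_t)_{t ≤ T}` satisfies the equation
`⟨μ_t, φ⟩ = ⟨Law(X_0), φ⟩ + ∫_0^t ⟨μ_s, ℒφ⟩ ds + ∑_{k=1}^{⌊t/ε⌋} ⟨μ_{t_k-}, φ (exp{ΔY_k' h - ε h'h/2} - 1)⟩`
for all `t ≤ T`, almost surely, for every `φ` such that `φ` and `ℒφ` are bounded and measurable. The
weak left limits `μ_{t_k-}` and the time integral are required to exist. -/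
structure SatisfiesZakai (P₀ : Measure Ω) (X : ℝ≥0 → Ω → Euc d₁) (h : 𝓢(Euc d₁, Euc d₂))
    (ε : ℝ≥0) (Y : ℕ → Ω → Euc d₂) (T : ℝ≥0) (μ : ℝ≥0 → Ω → FiniteMeasure (Euc d₁)) : Prop where
  left_limits : ∀ᵐ ω ∂P₀, ∀ k : ℕ, 1 ≤ k → obsTime ε k ≤ T →
    ∃ l, Tendsto (fun s => μ s ω) (𝓝[<] obsTime ε k) (𝓝 l)
  equation : ∀ φ g : Euc d₁ → ℂ, HasGenerator P₀ X φ g → ∀ᵐ ω ∂P₀, ∀ t, t ≤ T →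
    IntervalIntegrable (fun s : ℝ => ∫ x, g x ∂(μ s.toNNReal ω : Measure (Euc d₁))) volume 0 t ∧
    ∫ x, φ x ∂(μ t ω : Measure (Euc d₁)) =
      ∫ x, φ x ∂(P₀.map (X 0)) +
      (∫ s in (0 : ℝ)..t, ∫ x, g x ∂(μ s.toNNReal ω : Measure (Euc d₁))) +
      ∑ k ∈ Finset.Icc 1 ⌊t / ε⌋₊,
        ∫ x, φ x * ((Real.exp (⟪Y k ω - Y (k - 1) ω, h x⟫ - ε * ‖h x‖ ^ 2 / 2) - 1 : ℝ) : ℂ)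
          ∂((Function.leftLim (fun s => μ s ω) (obsTime ε k) : FiniteMeasure (Euc d₁)) :
            Measure (Euc d₁))

end ContinuousDiscreteFilter

end

/-! Fix the observation increments y_k. The filter is then a deterministic path of measures: it
starts at the law of X_0, is convolved with the increment laws of X between observation times, and
is multiplied at t_k by the likelihood exp{y_k'h - εh'h/2}. This path is `filterPath`; existence,
the equation and uniqueness are all obtained by comparison with it.

It is the filter. Given the path of X, the density η_T is a Cameron–Martin density for the Gaussian
noise increments; hence under P the observation increments are white noise independent of X, and X
keeps its law (`map_refMeasure`). Since η_t⁻¹ is the likelihood of the increments along X,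
conditioning on 𝒴^t amounts to averaging over the path of X with the observations held fixed
(`IsLevyStable.integral_filter_ae_eq_condExp`). Independence of the increments of X turns this
average into the recursion above (`IsLevyStable.filterPath_eq_map_withDensity`).

It solves (4). Between observations the pairing with φ has right derivative equal to the pairing
with ℒφ, and boundedness of the difference quotients makes it Lipschitz, so the fundamental theorem
of calculus applies. At t_k, multiplying by the likelihood adds the integral of φ(likelihood - 1)
against the left limit (`filterPath_equation`).

It is the only solution. A character satisfies ℒφ = -ψ(θ)φ, so between observations the
characteristic function of a solution obeys a scalar linear equation and is determined by its value
at the last observation time; the left limit then determines the jump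
(`eq_filterPath_of_evolutionEquation`). By continuity of characteristic functions a countable dense
set of θ suffices, so the exceptional sets have a null union. Any other càdlàg version of the filter
agrees with this one off a null set, by the same countability argument in θ and in time. -/

noncomputable section

namespace ContinuousDiscreteFilter

/-! ### The filter as a deterministic function of the observations -/

/-- The likelihood `exp (y' h(x) - ε (h'h)(x) / 2)` of an observation increment `y` at state `x`. -/
def obsWeight {d₁ d₂ : ℕ} (h : 𝓢(Euc d₁, Euc d₂)) (ε : ℝ≥0) (y : Euc d₂) (x : Euc d₁) : ℝ :=
  Real.exp (⟪y, h x⟫ - ε * ‖h x‖ ^ 2 / 2)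

/-- A weakly continuous convolution semigroup of probability measures. -/
structure IsConvSemigroup {d : ℕ} (π : ℝ≥0 → ProbabilityMeasure (Euc d)) : Prop where
  zero : (π 0 : Measure (Euc d)) = Measure.dirac 0
  add : ∀ s t, (π (s + t) : Measure (Euc d)) = (π s : Measure (Euc d)).conv (π t : Measure (Euc d))
  continuous : Continuous π

/-- The evolution of a finite measure under a convolution semigroup. -/
def propagate {d : ℕ} (π : ℝ≥0 → ProbabilityMeasure (Euc d)) (ρ : FiniteMeasure (Euc d)) (r : ℝ≥0) :
    FiniteMeasure (Euc d) :=
  ⟨(ρ : Measure (Euc d)).conv (π r : Measure (Euc d)), inferInstance⟩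

section Weight

variable {d₁ d₂ : ℕ} (h : 𝓢(Euc d₁, Euc d₂)) (ε : ℝ≥0)

lemma exists_norm_schwartz_le : ∃ C : ℝ, ∀ x, ‖h x‖ ≤ C :=
  ⟨_, fun x => h.toBoundedContinuousFunction.norm_coe_le_norm x⟩

lemma obsWeight_def (y : Euc d₂) (x : Euc d₁) :
    obsWeight h ε y x = Real.exp (⟪y, h x⟫ - ε * ‖h x‖ ^ 2 / 2) := rfl

lemma obsWeight_pos (y : Euc d₂) (x : Euc d₁) : 0 < obsWeight h ε y x := Real.exp_pos _

lemma exists_obsWeight_le (y : Euc d₂) : ∃ C : ℝ, ∀ x, obsWeight h ε y x ≤ C := by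
  obtain ⟨C, hC⟩ := exists_norm_schwartz_le h
  refine ⟨Real.exp (‖y‖ * C), fun x => Real.exp_le_exp.2 ?_⟩
  have h1 : ⟪y, h x⟫ ≤ ‖y‖ * C :=
    (real_inner_le_norm _ _).trans (mul_le_mul_of_nonneg_left (hC x) (norm_nonneg _))
  have h2 : 0 ≤ (ε : ℝ) * ‖h x‖ ^ 2 / 2 := by positivity
  linarith

lemma measurable_obsWeight_uncurry :
    Measurable (fun p : Euc d₂ × Euc d₁ => obsWeight h ε p.1 p.2) := by
  have := h.continuous
  have : Continuous (fun p : Euc d₂ × Euc d₁ => obsWeight h ε p.1 p.2) := by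
    unfold obsWeight; fun_prop
  exact this.measurable

lemma continuous_obsWeight (y : Euc d₂) : Continuous (obsWeight h ε y) := by
  have := h.continuous
  unfold obsWeight; fun_prop

lemma measurable_obsWeight (y : Euc d₂) : Measurable (obsWeight h ε y) :=
  (continuous_obsWeight h ε y).measurable

lemma isFiniteMeasure_withDensity_obsWeight (y : Euc d₂) (ρ : Measure (Euc d₁))
    [IsFiniteMeasure ρ] :
    IsFiniteMeasure (ρ.withDensity fun x => ENNReal.ofReal (obsWeight h ε y x)) := by
  obtain ⟨C, hC⟩ := exists_obsWeight_le h ε y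
  refine isFiniteMeasure_withDensity ?_
  refine ((lintegral_mono fun x => ENNReal.ofReal_le_ofReal (hC x)).trans_lt ?_).ne
  rw [lintegral_const]
  exact ENNReal.mul_lt_top ENNReal.ofReal_lt_top (measure_lt_top _ _)

end Weight

attribute [irreducible] obsWeight

/-- The unnormalized filter at the observation times, as a function of the observation
increments `y`. -/
def discreteFilter {d₁ d₂ : ℕ} (π : ℝ≥0 → ProbabilityMeasure (Euc d₁)) (ρ : FiniteMeasure (Euc d₁))
    (h : 𝓢(Euc d₁, Euc d₂)) (ε : ℝ≥0) (y : ℕ → Euc d₂) : ℕ → FiniteMeasure (Euc d₁)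
  | 0 => ρ
  | k + 1 =>
    ⟨(propagate π (discreteFilter π ρ h ε y k) ε : Measure (Euc d₁)).withDensity
      fun x => ENNReal.ofReal (obsWeight h ε (y (k + 1)) x),
      isFiniteMeasure_withDensity_obsWeight h ε _ _⟩

/-- The unnormalized filter as a function of the observation increments `y`. -/
def filterPath {d₁ d₂ : ℕ} (π : ℝ≥0 → ProbabilityMeasure (Euc d₁)) (ρ : FiniteMeasure (Euc d₁))
    (h : 𝓢(Euc d₁, Euc d₂)) (ε : ℝ≥0) (y : ℕ → Euc d₂) (t : ℝ≥0) : FiniteMeasure (Euc d₁) :=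
  propagate π (discreteFilter π ρ h ε y ⌊t / ε⌋₊) (t - obsTime ε ⌊t / ε⌋₊)

section ObsTime

variable {ε : ℝ≥0}

lemma obsTime_succ (k : ℕ) : obsTime ε (k + 1) = obsTime ε k + ε := by
  simp [obsTime, add_mul]

lemma obsTime_mono : Monotone (obsTime ε) := fun a b hab => by
  unfold obsTime; gcongr

/-- The dictionary between times and observation indices, through which the floor arguments pass. -/
lemma obsTime_le_iff (hε : 0 < ε) {k : ℕ} {t : ℝ≥0} : obsTime ε k ≤ t ↔ k ≤ ⌊t / ε⌋₊ := by
  rw [Nat.le_floor_iff (zero_le), le_div_iff₀ hε, obsTime]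

lemma obsTime_floor_le (hε : 0 < ε) (t : ℝ≥0) : obsTime ε ⌊t / ε⌋₊ ≤ t :=
  (obsTime_le_iff hε).2 le_rfl

lemma lt_obsTime_floor_succ (hε : 0 < ε) (t : ℝ≥0) : t < obsTime ε (⌊t / ε⌋₊ + 1) := by
  rw [← not_le, obsTime_le_iff hε]; omega

lemma floor_eq_of_mem (hε : 0 < ε) {k : ℕ} {t : ℝ≥0} (h1 : obsTime ε k ≤ t)
    (h2 : t < obsTime ε (k + 1)) : ⌊t / ε⌋₊ = k := by
  have h1' := (obsTime_le_iff hε).1 h1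
  have h2' := mt (obsTime_le_iff hε).2 (not_le.2 h2)
  omega

lemma floor_obsTime (hε : 0 < ε) (k : ℕ) : ⌊obsTime ε k / ε⌋₊ = k := by
  refine floor_eq_of_mem hε le_rfl ?_
  rw [obsTime_succ]
  exact lt_add_of_pos_right _ hε

end ObsTime

section Propagate

variable {d : ℕ} {π : ℝ≥0 → ProbabilityMeasure (Euc d)}

lemma coe_propagate (ρ : FiniteMeasure (Euc d)) (r : ℝ≥0) :
    (propagate π ρ r : Measure (Euc d)) = (ρ : Measure (Euc d)).conv (π r : Measure (Euc d)) := rfl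

lemma IsConvSemigroup.propagate_zero (hπ : IsConvSemigroup π) (ρ : FiniteMeasure (Euc d)) :
    propagate π ρ 0 = ρ := by
  apply Subtype.ext
  change (propagate π ρ 0 : Measure (Euc d)) = ρ
  rw [coe_propagate, hπ.zero, Measure.conv_dirac_zero]

lemma IsConvSemigroup.propagate_add (hπ : IsConvSemigroup π) (ρ : FiniteMeasure (Euc d))
    (r s : ℝ≥0) : propagate π (propagate π ρ r) s = propagate π ρ (r + s) := by
  apply Subtype.ext
  change (propagate π (propagate π ρ r) s : Measure (Euc d)) = propagate π ρ (r + s)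
  rw [coe_propagate, coe_propagate, coe_propagate, hπ.add, Measure.conv_assoc]

lemma integral_propagate (ρ : FiniteMeasure (Euc d)) (r : ℝ≥0) {φ : Euc d → ℂ}
    (hφ : IsBoundedMeasurable φ) :
    ∫ x, φ x ∂(propagate π ρ r : Measure (Euc d)) =
      ∫ x, ∫ z, φ (x + z) ∂(π r : Measure (Euc d)) ∂(ρ : Measure (Euc d)) := by
  obtain ⟨hm, C, hC⟩ := hφ
  rw [coe_propagate]
  refine integral_conv ?_
  exact Integrable.of_bound hm.aestronglyMeasurable C (ae_of_all _ hC)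

/-- Swapping the two factors of the convolution turns the integral of f into the integral, against
the law at time s, of one fixed bounded continuous function: the ρ-average of the translates of f.
Weak continuity of π then suffices. -/
lemma continuous_propagate (hπ : Continuous π) (ρ : FiniteMeasure (Euc d)) :
    Continuous (propagate π ρ) := by
  rw [continuous_iff_continuousAt]
  intro r
  rw [ContinuousAt, FiniteMeasure.tendsto_iff_forall_integral_tendsto]
  intro f
  have key : ∀ s, ∫ x, f x ∂(propagate π ρ s : Measure (Euc d)) =
      ∫ z, ∫ x, f (x + z) ∂(ρ : Measure (Euc d)) ∂(π s : Measure (Euc d)) := by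
    intro s
    rw [coe_propagate, Measure.conv_comm]
    rw [integral_conv (f.integrable _)]
    simp_rw [add_comm]
  simp_rw [key]
  have hcont : Continuous fun z => ∫ x, f (x + z) ∂(ρ : Measure (Euc d)) := by
    refine continuous_of_dominated (bound := fun _ => ‖f‖) ?_ ?_ ?_ ?_
    · intro z
      exact (f.continuous.comp (continuous_id.add continuous_const)).aestronglyMeasurable
    · exact fun z => ae_of_all _ fun x => f.norm_coe_le_norm _
    · exact integrable_const _
    · exact ae_of_all _ fun x => f.continuous.comp (continuous_const.add continuous_id)
  let F : BoundedContinuousFunction (Euc d) ℝ :=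
    BoundedContinuousFunction.ofNormedAddCommGroup _ hcont (‖f‖ * (ρ : Measure (Euc d)).real univ)
      fun z => norm_integral_le_of_norm_le_const (ae_of_all _ fun x => f.norm_coe_le_norm _)
  exact (ProbabilityMeasure.tendsto_iff_forall_integral_tendsto.1 (hπ.tendsto r)) F

end Propagate

/-! ### Regularity of the filter path -/

section Path

variable {d₁ d₂ : ℕ} {π : ℝ≥0 → ProbabilityMeasure (Euc d₁)} {ρ : FiniteMeasure (Euc d₁)}
  {h : 𝓢(Euc d₁, Euc d₂)} {ε : ℝ≥0} {y : ℕ → Euc d₂}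

lemma coe_discreteFilter_succ (k : ℕ) :
    (discreteFilter π ρ h ε y (k + 1) : Measure (Euc d₁)) =
    (propagate π (discreteFilter π ρ h ε y k) ε : Measure (Euc d₁)).withDensity
      fun x => ENNReal.ofReal (obsWeight h ε (y (k + 1)) x) := rfl

lemma filterPath_of_mem (hε : 0 < ε) {k : ℕ} {t : ℝ≥0} (h1 : obsTime ε k ≤ t)
    (h2 : t < obsTime ε (k + 1)) :
    filterPath π ρ h ε y t = propagate π (discreteFilter π ρ h ε y k) (t - obsTime ε k) := by
  rw [filterPath, floor_eq_of_mem hε h1 h2]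

lemma tendsto_filterPath_right (hπ : IsConvSemigroup π) (hε : 0 < ε) (t : ℝ≥0) :
    ContinuousWithinAt (filterPath π ρ h ε y) (Ici t) t := by
  have hc : Continuous fun s =>
      propagate π (discreteFilter π ρ h ε y ⌊t / ε⌋₊) (s - obsTime ε ⌊t / ε⌋₊) :=
    (continuous_propagate hπ.continuous _).comp (by fun_prop)
  refine (hc.continuousWithinAt (s := Ici t) (x := t)).congr_of_eventuallyEq ?_ rfl
  have hlt := lt_obsTime_floor_succ hε t
  filter_upwards [self_mem_nhdsWithin, mem_nhdsWithin_of_mem_nhds (Iio_mem_nhds hlt)] with s h1 h2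
  exact filterPath_of_mem hε ((obsTime_floor_le hε t).trans h1) h2

/-- The formula valid on [t_k, t_{k+1}) is continuous in time beyond that interval, so it also gives
the left limit at t_{k+1}: the measure before the jump. -/
lemma tendsto_filterPath_left (hπ : IsConvSemigroup π) (hε : 0 < ε) {k : ℕ} {t : ℝ≥0}
    (h1 : obsTime ε k < t) (h2 : t ≤ obsTime ε (k + 1)) :
    Tendsto (filterPath π ρ h ε y) (𝓝[<] t)
      (𝓝 (propagate π (discreteFilter π ρ h ε y k) (t - obsTime ε k))) := by
  have hc : Continuous fun s =>
      propagate π (discreteFilter π ρ h ε y k) (s - obsTime ε k) :=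
    (continuous_propagate hπ.continuous _).comp (by fun_prop)
  refine Tendsto.congr' ?_ ((hc.tendsto t).mono_left nhdsWithin_le_nhds)
  filter_upwards [self_mem_nhdsWithin, mem_nhdsWithin_of_mem_nhds (Ioi_mem_nhds h1)] with s hs hs'
  exact (filterPath_of_mem hε (le_of_lt hs') (lt_of_lt_of_le hs h2)).symm

lemma tendsto_filterPath_obsTime (hπ : IsConvSemigroup π) (hε : 0 < ε) (k : ℕ) :
    Tendsto (filterPath π ρ h ε y) (𝓝[<] obsTime ε (k + 1))
      (𝓝 (propagate π (discreteFilter π ρ h ε y k) ε)) := by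
  have := tendsto_filterPath_left (ρ := ρ) (h := h) (y := y) hπ hε (k := k)
    (t := obsTime ε (k + 1)) (by rw [obsTime_succ]; exact lt_add_of_pos_right _ hε) le_rfl
  rwa [obsTime_succ, add_tsub_cancel_left, ← obsTime_succ] at this

lemma isCadlag_filterPath (hπ : IsConvSemigroup π) (hε : 0 < ε) :
    IsCadlag (filterPath π ρ h ε y) := by
  refine fun t => ⟨tendsto_filterPath_right hπ hε t, ?_⟩
  by_cases ht : obsTime ε ⌊t / ε⌋₊ < t
  · exact ⟨_, tendsto_filterPath_left hπ hε ht (lt_obsTime_floor_succ hε t).le⟩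
  · have hteq : t = obsTime ε ⌊t / ε⌋₊ := le_antisymm (not_lt.1 ht) (obsTime_floor_le hε t)
    generalize ⌊t / ε⌋₊ = k at hteq
    subst hteq
    rcases k with _ | k
    -- No time precedes 0, so the left filter is trivial and any measure serves as the limit.
    · refine ⟨ρ, ?_⟩
      have h0 : obsTime ε 0 = 0 := by simp [obsTime]
      rw [h0]
      have : Iio (0 : ℝ≥0) = ∅ := by ext x; simp
      rw [this, nhdsWithin_empty]
      exact tendsto_bot
    · exact ⟨_, tendsto_filterPath_obsTime hπ hε k⟩

lemma discreteFilter_congr {y' : ℕ → Euc d₂} {n : ℕ} (hy : ∀ k, 1 ≤ k → k ≤ n → y k = y' k) :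
    discreteFilter π ρ h ε y n = discreteFilter π ρ h ε y' n := by
  induction n with
  | zero => rfl
  | succ n ih =>
    apply Subtype.ext
    change (discreteFilter π ρ h ε y (n + 1) : Measure (Euc d₁)) = discreteFilter π ρ h ε y' (n + 1)
    rw [coe_discreteFilter_succ, coe_discreteFilter_succ,
      ih fun k h1 h2 => hy k h1 (h2.trans n.le_succ), hy (n + 1) (by omega) le_rfl]

lemma filterPath_congr {y' : ℕ → Euc d₂} {t : ℝ≥0}
    (hy : ∀ k, 1 ≤ k → k ≤ ⌊t / ε⌋₊ → y k = y' k) :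
    filterPath π ρ h ε y t = filterPath π ρ h ε y' t := by
  rw [filterPath, discreteFilter_congr hy, filterPath]

lemma isCadlag_min {S : Type*} [TopologicalSpace S] {f : ℝ≥0 → S} (hf : IsCadlag f) (T : ℝ≥0) :
    IsCadlag fun t => f (min t T) := by
  intro t
  constructor
  · refine ContinuousWithinAt.comp (t := Ici (min t T)) (hf _).1 ?_ ?_
    · fun_prop
    · intro s hs
      exact min_le_min_right T hs
  · rcases le_or_gt t T with htT | htT
    · obtain ⟨l, hl⟩ := (hf t).2
      refine ⟨l, hl.congr' ?_⟩
      filter_upwards [self_mem_nhdsWithin] with s hs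
      rw [min_eq_left ((le_of_lt hs).trans htT)]
    · refine ⟨f T, tendsto_const_nhds.congr' ?_⟩
      filter_upwards [mem_nhdsWithin_of_mem_nhds (Ioi_mem_nhds htT)] with s hs
      rw [min_eq_right (le_of_lt hs)]

lemma IsCadlag.eq_of_dense {S : Type*} [TopologicalSpace S] [T2Space S] {f g : ℝ≥0 → S}
    (hf : IsCadlag f) (hg : IsCadlag g) {D : Set ℝ≥0} (hD : Dense D) (h : ∀ t ∈ D, f t = g t) :
    f = g := by
  funext t
  -- Every t is approached strictly from the right by points of D, so right continuity alone decides
  -- the value at t.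
  have hcl : t ∈ closure (Ioi t ∩ D) := by
    have : t ∈ closure (Ioi t) := by rw [closure_Ioi]; exact self_mem_Ici
    exact closure_minimal (hD.open_subset_closure_inter isOpen_Ioi) isClosed_closure this
  have : (𝓝[Ioi t ∩ D] t).NeBot := mem_closure_iff_nhdsWithin_neBot.1 hcl
  have hsub : Ioi t ∩ D ⊆ Ici t := fun s hs => mem_Ici.2 (le_of_lt (mem_Ioi.1 hs.1))
  have h1 : Tendsto f (𝓝[Ioi t ∩ D] t) (𝓝 (f t)) := (hf t).1.mono_left (nhdsWithin_mono _ hsub)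
  have h2 : Tendsto g (𝓝[Ioi t ∩ D] t) (𝓝 (g t)) := (hg t).1.mono_left (nhdsWithin_mono _ hsub)
  refine tendsto_nhds_unique h1 (h2.congr' ?_)
  filter_upwards [self_mem_nhdsWithin] with s hs using (h s hs.2).symm

end Path

/-! ### The generator and the evolution equation -/

/-- `π` is the family of laws of the increments of `X`. -/
structure IsIncrementLaw {Ω : Type*} [MeasurableSpace Ω] {d : ℕ} (P₀ : Measure Ω)
    (X : ℝ≥0 → Ω → Euc d) (π : ℝ≥0 → ProbabilityMeasure (Euc d)) : Prop where
  measurable : ∀ t, Measurable (X t)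
  law : ∀ t, (π t : Measure (Euc d)) = P₀.map fun ω => X t ω - X 0 ω
  isConvSemigroup : IsConvSemigroup π

section Generator

variable {Ω : Type*} [MeasurableSpace Ω] {d : ℕ} {P₀ : Measure Ω}
  {X : ℝ≥0 → Ω → Euc d} {π : ℝ≥0 → ProbabilityMeasure (Euc d)}

lemma IsBoundedMeasurable.integrable {φ : Euc d → ℂ} (hφ : IsBoundedMeasurable φ)
    (ρ : Measure (Euc d)) [IsFiniteMeasure ρ] : Integrable φ ρ := by
  obtain ⟨hm, C, hC⟩ := hφ
  exact Integrable.of_bound hm.aestronglyMeasurable C (ae_of_all _ hC)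

lemma IsIncrementLaw.semigroup_eq (hX : IsIncrementLaw P₀ X π) (t : ℝ≥0) {φ : Euc d → ℂ}
    (hφ : Measurable φ) (x : Euc d) :
    semigroup P₀ X t φ x = ∫ z, φ (x + z) ∂(π t : Measure (Euc d)) := by
  have hm : Measurable fun ω => X t ω - X 0 ω := (hX.measurable t).sub (hX.measurable 0)
  have hφ' : Measurable fun z => φ (x + z) := hφ.comp (measurable_id.const_add x)
  rw [hX.law, integral_map hm.aemeasurable hφ'.aestronglyMeasurable]
  rfl

lemma IsIncrementLaw.integral_propagate_semigroup (hX : IsIncrementLaw P₀ X π)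
    (ρ : FiniteMeasure (Euc d)) {φ : Euc d → ℂ} (hφ : IsBoundedMeasurable φ) (r s : ℝ≥0) :
    ∫ x, φ x ∂(propagate π ρ (r + s) : Measure (Euc d)) =
      ∫ x, semigroup P₀ X s φ x ∂(propagate π ρ r : Measure (Euc d)) := by
  rw [← hX.isConvSemigroup.propagate_add, integral_propagate _ _ hφ]
  exact integral_congr_ae (ae_of_all _ fun x => (hX.semigroup_eq s hφ.1 x).symm)

lemma IsIncrementLaw.measurable_semigroup (hX : IsIncrementLaw P₀ X π) (t : ℝ≥0) {φ : Euc d → ℂ}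
    (hφ : Measurable φ) : Measurable (semigroup P₀ X t φ) := by
  have : semigroup P₀ X t φ = fun x => ∫ z, φ (x + z) ∂(π t : Measure (Euc d)) :=
    funext fun x => hX.semigroup_eq t hφ x
  rw [this]
  have hm : StronglyMeasurable (Function.uncurry fun x z : Euc d => φ (x + z)) :=
    (hφ.comp (measurable_fst.add measurable_snd)).stronglyMeasurable
  exact hm.integral_prod_right.measurable

lemma propagate_real_univ (ρ : FiniteMeasure (Euc d)) (r : ℝ≥0) :
    (propagate π ρ r : Measure (Euc d)).real univ = (ρ : Measure (Euc d)).real univ := by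
  rw [coe_propagate, Measure.real, Measure.real, Measure.conv,
    Measure.map_apply (by fun_prop) MeasurableSet.univ, preimage_univ, ← univ_prod_univ,
    Measure.prod_prod, measure_univ (μ := (π r : Measure (Euc d))), mul_one]

/-- Duality between measures and functions: the difference quotient in time of the evolved measure
is the integral of the quotient that defines the generator. -/
lemma IsIncrementLaw.integral_propagate_sub (hX : IsIncrementLaw P₀ X π)
    (ρ : FiniteMeasure (Euc d)) {φ : Euc d → ℂ} (hφ : IsBoundedMeasurable φ) {s : ℝ≥0}
    (hs : Integrable (fun x => (s : ℂ)⁻¹ * (semigroup P₀ X s φ x - φ x))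
      (ρ : Measure (Euc d))) (hs0 : 0 < s) :
    (s : ℂ)⁻¹ * (∫ x, φ x ∂(propagate π ρ s : Measure (Euc d)) -
      ∫ x, φ x ∂(ρ : Measure (Euc d))) =
      ∫ x, (s : ℂ)⁻¹ * (semigroup P₀ X s φ x - φ x) ∂(ρ : Measure (Euc d)) := by
  have hint := hφ.integrable (ρ : Measure (Euc d))
  have hsc : (s : ℂ) ≠ 0 := by exact_mod_cast hs0.ne'
  have h2 : Integrable (semigroup P₀ X s φ) (ρ : Measure (Euc d)) := by
    have := (hs.const_mul (s : ℂ)).add hint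
    refine this.congr (ae_of_all _ fun x => ?_)
    simp [mul_inv_cancel_left₀ hsc]
  have := hX.integral_propagate_semigroup ρ hφ 0 s
  rw [zero_add, hX.isConvSemigroup.propagate_zero] at this
  rw [this, integral_const_mul, integral_sub h2 hint]

variable {φ g : Euc d → ℂ}

lemma HasGenerator.integrable_quotient (hX : IsIncrementLaw P₀ X π) (hg : HasGenerator P₀ X φ g)
    (ρ : Measure (Euc d)) [IsFiniteMeasure ρ] {s : ℝ≥0} (hs : 0 < s) :
    Integrable (fun x => (s : ℂ)⁻¹ * (semigroup P₀ X s φ x - φ x)) ρ := by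
  obtain ⟨C, hC⟩ := hg.bounded_quotient
  refine Integrable.of_bound ?_ C (ae_of_all _ (hC s hs))
  have := hX.measurable_semigroup s hg.bounded_left.1
  have := hg.bounded_left.1
  exact Measurable.aestronglyMeasurable (by fun_prop)

/-- By the semigroup property a right derivative at time r is one at time 0 started from the measure
at time r. There the limit passes under the integral by dominated convergence, the quotients being
uniformly bounded. -/
lemma HasGenerator.tendsto_integral (hX : IsIncrementLaw P₀ X π) (hg : HasGenerator P₀ X φ g)
    (ρ : FiniteMeasure (Euc d)) (r : ℝ≥0) :
    Tendsto (fun s : ℝ≥0 => (s : ℂ)⁻¹ * (∫ x, φ x ∂(propagate π ρ (r + s) : Measure (Euc d)) -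
      ∫ x, φ x ∂(propagate π ρ r : Measure (Euc d)))) (𝓝[>] 0)
      (𝓝 (∫ x, g x ∂(propagate π ρ r : Measure (Euc d)))) := by
  obtain ⟨C, hC⟩ := hg.bounded_quotient
  have : Tendsto (fun s : ℝ≥0 => ∫ x, (s : ℂ)⁻¹ * (semigroup P₀ X s φ x - φ x)
      ∂(propagate π ρ r : Measure (Euc d))) (𝓝[>] 0)
      (𝓝 (∫ x, g x ∂(propagate π ρ r : Measure (Euc d)))) := by
    refine tendsto_integral_filter_of_dominated_convergence (fun _ => C) ?_ ?_ ?_ ?_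
    · filter_upwards [self_mem_nhdsWithin] with s hs
      exact (hg.integrable_quotient hX _ hs).aestronglyMeasurable
    · filter_upwards [self_mem_nhdsWithin] with s hs
      exact ae_of_all _ (hC s hs)
    · exact integrable_const _
    · exact ae_of_all _ hg.tendsto_quotient
  refine this.congr' ?_
  filter_upwards [self_mem_nhdsWithin] with s hs
  rw [← hX.isConvSemigroup.propagate_add]
  exact (hX.integral_propagate_sub _ hg.bounded_left (hg.integrable_quotient hX _ hs) hs).symm

/-- Weak continuity says nothing about a φ that is merely measurable; continuity in time comes
instead from the uniform bound on the quotients times the total mass, which propagation preserves.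
The maximum with 0 makes the constant visibly nonnegative. -/
lemma HasGenerator.exists_lipschitz (hX : IsIncrementLaw P₀ X π) (hg : HasGenerator P₀ X φ g)
    (ρ : FiniteMeasure (Euc d)) :
    ∃ K : ℝ≥0, LipschitzWith K fun s : ℝ =>
      ∫ x, φ x ∂(propagate π ρ s.toNNReal : Measure (Euc d)) := by
  obtain ⟨C, hC⟩ := hg.bounded_quotient
  set M : ℝ := C * (ρ : Measure (Euc d)).real univ
  have key : ∀ r s : ℝ≥0, ‖∫ x, φ x ∂(propagate π ρ (r + s) : Measure (Euc d)) -
      ∫ x, φ x ∂(propagate π ρ r : Measure (Euc d))‖ ≤ max M 0 * s := by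
    intro r s
    rcases eq_or_lt_of_le (zero_le (a := s)) with rfl | hs
    · simp
    have hsc : (s : ℂ) ≠ 0 := by exact_mod_cast hs.ne'
    have hsr : (0 : ℝ) < s := by exact_mod_cast hs
    have h1 := hX.integral_propagate_sub (propagate π ρ r) hg.bounded_left
      (hg.integrable_quotient hX _ hs) hs
    rw [hX.isConvSemigroup.propagate_add] at h1
    have h2 := norm_integral_le_of_norm_le_const (μ := (propagate π ρ r : Measure (Euc d)))
      (ae_of_all _ (hC s hs))
    rw [← h1, propagate_real_univ, norm_mul, norm_inv, inv_mul_le_iff₀ (norm_pos_iff.2 hsc)] at h2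
    have hn : ‖(s : ℂ)‖ = s := by
      rw [show (s : ℂ) = ((s : ℝ) : ℂ) from rfl, Complex.norm_real, Real.norm_of_nonneg hsr.le]
    rw [hn, mul_comm] at h2
    exact h2.trans (mul_le_mul_of_nonneg_right (le_max_left _ _) hsr.le)
  refine ⟨(max M 0).toNNReal, LipschitzWith.of_dist_le_mul fun a b => ?_⟩
  rw [Real.coe_toNNReal _ (le_max_right _ _)]
  wlog hab : a ≤ b generalizing a b
  · rw [dist_comm, dist_comm a]
    exact this b a (le_of_not_ge hab)
  have h1 := key a.toNNReal (b.toNNReal - a.toNNReal)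
  rw [add_tsub_cancel_of_le (Real.toNNReal_mono hab)] at h1
  rw [dist_comm, dist_eq_norm]
  refine h1.trans (mul_le_mul_of_nonneg_left ?_ (le_max_right _ _))
  rw [NNReal.coe_sub (Real.toNNReal_mono hab), dist_comm, Real.dist_eq,
    abs_of_nonneg (sub_nonneg.2 hab)]
  rw [Real.coe_toNNReal', Real.coe_toNNReal']
  rcases le_total 0 a with h | h <;> rcases le_total 0 b with h' | h' <;>
    simp only [max_eq_left, max_eq_right, h, h'] <;> linarith

lemma HasGenerator.hasDerivWithinAt (hX : IsIncrementLaw P₀ X π) (hg : HasGenerator P₀ X φ g)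
    (ρ : FiniteMeasure (Euc d)) {s : ℝ} (hs : 0 ≤ s) :
    HasDerivWithinAt (fun s : ℝ => ∫ x, φ x ∂(propagate π ρ s.toNNReal : Measure (Euc d)))
      (∫ x, g x ∂(propagate π ρ s.toNNReal : Measure (Euc d))) (Ioi s) s := by
  rw [hasDerivWithinAt_iff_tendsto_slope' self_notMem_Ioi]
  have h1 := hg.tendsto_integral hX ρ s.toNNReal
  have h2 : Tendsto (fun u : ℝ => (u - s).toNNReal) (𝓝[>] s) (𝓝[>] 0) := by
    refine tendsto_nhdsWithin_iff.2 ⟨?_, ?_⟩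
    · have : Tendsto (fun u : ℝ => (u - s).toNNReal) (𝓝 s) (𝓝 (s - s).toNNReal) := by
        apply Continuous.tendsto (f := fun u : ℝ => (u - s).toNNReal)
        fun_prop
      rw [sub_self, Real.toNNReal_zero] at this
      exact this.mono_left nhdsWithin_le_nhds
    · filter_upwards [self_mem_nhdsWithin] with u hu
      exact Real.toNNReal_pos.2 (sub_pos.2 hu)
  refine (h1.comp h2).congr' ?_
  filter_upwards [self_mem_nhdsWithin] with u hu
  have hus : 0 ≤ u - s := (sub_pos.2 hu).le
  have h3 : s.toNNReal + (u - s).toNNReal = u.toNNReal := by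
    rw [← Real.toNNReal_add hs hus]; congr 1; ring
  simp only [Function.comp, h3, slope, vsub_eq_sub]
  rw [show (((u - s).toNNReal : ℝ≥0) : ℂ) = (((u - s).toNNReal : ℝ) : ℂ) from rfl,
    Real.coe_toNNReal _ hus, ← Complex.ofReal_inv, Complex.real_smul]

/-- Here g is only measurable in space. Measurability in time holds because the function is a
pointwise limit of difference quotients, with steps 1/(n+1), of a continuous function. -/
lemma HasGenerator.measurable_integral (hX : IsIncrementLaw P₀ X π) (hg : HasGenerator P₀ X φ g)
    (ρ : FiniteMeasure (Euc d)) :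
    Measurable fun s : ℝ => ∫ x, g x ∂(propagate π ρ s.toNNReal : Measure (Euc d)) := by
  obtain ⟨K, hK⟩ := hg.exists_lipschitz hX ρ
  have hF : Measurable fun s : ℝ≥0 => ∫ x, φ x ∂(propagate π ρ s : Measure (Euc d)) := by
    have := hK.continuous.comp NNReal.continuous_coe
    simpa [Function.comp_def] using this.measurable
  have h0 : Tendsto (fun n : ℕ => (1 / ((n : ℝ≥0) + 1))) atTop (𝓝[>] 0) :=
    tendsto_nhdsWithin_iff.2 ⟨tendsto_one_div_add_atTop_nhds_zero_nat, .of_forall fun n => by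
      simp only [mem_Ioi]; positivity⟩
  have : Measurable fun s : ℝ≥0 => ∫ x, g x ∂(propagate π ρ s : Measure (Euc d)) := by
    refine measurable_of_tendsto_metrizable (f := fun (n : ℕ) (s : ℝ≥0) =>
      (((1 / ((n : ℝ≥0) + 1) : ℝ≥0)) : ℂ)⁻¹ *
        (∫ x, φ x ∂(propagate π ρ (s + 1 / ((n : ℝ≥0) + 1)) : Measure (Euc d)) -
      ∫ x, φ x ∂(propagate π ρ s : Measure (Euc d)))) ?_ ?_
    · intro n
      exact ((hF.comp (measurable_id.add_const _)).sub hF).const_mul _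
    · rw [tendsto_pi_nhds]
      exact fun s => (hg.tendsto_integral hX ρ s).comp h0
  exact this.comp measurable_real_toNNReal

lemma HasGenerator.intervalIntegrable (hX : IsIncrementLaw P₀ X π) (hg : HasGenerator P₀ X φ g)
    (ρ : FiniteMeasure (Euc d)) (a b : ℝ) :
    IntervalIntegrable (fun s : ℝ => ∫ x, g x ∂(propagate π ρ s.toNNReal : Measure (Euc d)))
      volume a b := by
  obtain ⟨C, hC⟩ := hg.bounded_right.2
  refine IntervalIntegrable.mono_fun (f := fun _ => C * (ρ : Measure (Euc d)).real univ)
    (intervalIntegrable_const) (hg.measurable_integral hX ρ).aestronglyMeasurable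
    (ae_of_all _ fun s => ?_)
  refine (norm_integral_le_of_norm_le_const (ae_of_all _ hC)).trans ?_
  rw [propagate_real_univ]
  exact le_abs_self _

/-- The generator provides right derivatives only. For a continuous function with an integrable
right derivative this is enough for the fundamental theorem of calculus. -/
lemma HasGenerator.integral_eq (hX : IsIncrementLaw P₀ X π) (hg : HasGenerator P₀ X φ g)
    (ρ : FiniteMeasure (Euc d)) {r : ℝ} (hr : 0 ≤ r) :
    ∫ s in (0 : ℝ)..r, ∫ x, g x ∂(propagate π ρ s.toNNReal : Measure (Euc d)) =
      ∫ x, φ x ∂(propagate π ρ r.toNNReal : Measure (Euc d)) - ∫ x, φ x ∂(ρ : Measure (Euc d)) := by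
  obtain ⟨K, hK⟩ := hg.exists_lipschitz hX ρ
  rw [intervalIntegral.integral_eq_sub_of_hasDeriv_right hK.continuous.continuousOn
    (fun s hs => hg.hasDerivWithinAt hX ρ ?_) (hg.intervalIntegrable hX ρ _ _)]
  · rw [Real.toNNReal_zero, hX.isConvSemigroup.propagate_zero]
  · rw [min_eq_left hr] at hs
    exact hs.1.le

/-- The evolution equation on an interval without observations. -/
lemma HasGenerator.evolution (hX : IsIncrementLaw P₀ X π) (hg : HasGenerator P₀ X φ g)
    (ρ : FiniteMeasure (Euc d)) {m : ℝ≥0 → FiniteMeasure (Euc d)} {a b : ℝ≥0} (hab : a ≤ b)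
    (hm : ∀ s, a ≤ s → s < b → m s = propagate π ρ (s - a)) :
    IntervalIntegrable (fun s : ℝ => ∫ x, g x ∂(m s.toNNReal : Measure (Euc d))) volume a b ∧
    ∫ s in (a : ℝ)..b, ∫ x, g x ∂(m s.toNNReal : Measure (Euc d)) =
      ∫ x, φ x ∂(propagate π ρ (b - a) : Measure (Euc d)) - ∫ x, φ x ∂(ρ : Measure (Euc d)) := by
  have hab' : (a : ℝ) ≤ b := NNReal.coe_le_coe.2 hab
  have hae : ∀ᵐ s : ℝ, s ∈ uIoc (a : ℝ) b →
      ∫ x, g x ∂(propagate π ρ (s - a).toNNReal : Measure (Euc d)) =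
      ∫ x, g x ∂(m s.toNNReal : Measure (Euc d)) := by
    -- At b the path may already have jumped; a single time does not affect the integral.
    have : ∀ᵐ s : ℝ, s ≠ b := by simp [ae_iff]
    filter_upwards [this] with s hsb hs
    rw [uIoc_of_le hab'] at hs
    have h1 : a ≤ s.toNNReal := by
      rw [← Real.toNNReal_coe (r := a)]; exact Real.toNNReal_mono hs.1.le
    have h2 : s.toNNReal < b := by
      rw [← Real.toNNReal_coe (r := b)]
      exact (Real.toNNReal_lt_toNNReal_iff_of_nonneg (a.2.trans hs.1.le)).2 (lt_of_le_of_ne hs.2 hsb)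
    rw [hm _ h1 h2, NNReal.sub_def, Real.coe_toNNReal _ (a.2.trans hs.1.le)]
  constructor
  · have h1 := (hg.intervalIntegrable hX ρ 0 ((b : ℝ) - a)).comp_sub_right (a : ℝ)
    rw [zero_add, sub_add_cancel] at h1
    refine h1.congr_ae ?_
    exact (ae_restrict_iff' measurableSet_uIoc).2 hae
  · rw [← intervalIntegral.integral_congr_ae hae,
      intervalIntegral.integral_comp_sub_right
        (fun s : ℝ => ∫ x, g x ∂(propagate π ρ s.toNNReal : Measure (Euc d))) (a : ℝ),
      sub_self, hg.integral_eq hX ρ (sub_nonneg.2 hab')]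
    rw [NNReal.sub_def]

end Generator

/-! ### The filter path solves the equation, observation by observation -/

section Equation

variable {Ω : Type*} [MeasurableSpace Ω] {d₁ d₂ : ℕ} {P₀ : Measure Ω}
  {X : ℝ≥0 → Ω → Euc d₁} {π : ℝ≥0 → ProbabilityMeasure (Euc d₁)} {ρ : FiniteMeasure (Euc d₁)}
  {h : 𝓢(Euc d₁, Euc d₂)} {ε : ℝ≥0} {y : ℕ → Euc d₂} {φ g : Euc d₁ → ℂ}

lemma isBoundedMeasurable_mul_obsWeight (hφ : IsBoundedMeasurable φ) (z : Euc d₂) :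
    IsBoundedMeasurable fun x => φ x * ((obsWeight h ε z x : ℝ) : ℂ) := by
  obtain ⟨hm, C, hC⟩ := hφ
  obtain ⟨D, hD⟩ := exists_obsWeight_le h ε z
  refine ⟨hm.mul (Complex.measurable_ofReal.comp (measurable_obsWeight h ε z)), C * D, fun x => ?_⟩
  rw [norm_mul, Complex.norm_real, Real.norm_of_nonneg (obsWeight_pos h ε z x).le]
  exact mul_le_mul (hC x) (hD x) (obsWeight_pos h ε z x).le ((norm_nonneg _).trans (hC x))

lemma integral_withDensity_obsWeight (ρ : Measure (Euc d₁)) (z : Euc d₂) (φ : Euc d₁ → ℂ) :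
    ∫ x, φ x ∂(ρ.withDensity fun x => ENNReal.ofReal (obsWeight h ε z x)) =
      ∫ x, φ x * ((obsWeight h ε z x : ℝ) : ℂ) ∂ρ := by
  rw [integral_withDensity_eq_integral_toReal_smul
    (measurable_obsWeight h ε z).ennreal_ofReal (ae_of_all _ fun _ => ENNReal.ofReal_lt_top)]
  refine integral_congr_ae (ae_of_all _ fun x => ?_)
  simp only [ENNReal.toReal_ofReal (obsWeight_pos h ε z x).le, Complex.real_smul]
  exact mul_comm _ _

/-- The jump of the unnormalized filter at an observation time. -/
lemma integral_discreteFilter_succ (hφ : IsBoundedMeasurable φ) (k : ℕ) :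
    ∫ x, φ x ∂(discreteFilter π ρ h ε y (k + 1) : Measure (Euc d₁)) =
      ∫ x, φ x ∂(propagate π (discreteFilter π ρ h ε y k) ε : Measure (Euc d₁)) +
      ∫ x, φ x * ((obsWeight h ε (y (k + 1)) x - 1 : ℝ) : ℂ)
        ∂(propagate π (discreteFilter π ρ h ε y k) ε : Measure (Euc d₁)) := by
  rw [coe_discreteFilter_succ, integral_withDensity_obsWeight]
  have h1 := hφ.integrable (propagate π (discreteFilter π ρ h ε y k) ε : Measure (Euc d₁))
  have h2 := (isBoundedMeasurable_mul_obsWeight (h := h) (ε := ε) hφ (y (k + 1))).integrable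
    (propagate π (discreteFilter π ρ h ε y k) ε : Measure (Euc d₁))
  have h3 : ∀ x, φ x * ((obsWeight h ε (y (k + 1)) x - 1 : ℝ) : ℂ) =
      φ x * ((obsWeight h ε (y (k + 1)) x : ℝ) : ℂ) - φ x := fun x => by push_cast; ring
  simp_rw [h3]
  rw [integral_sub h2 h1]; ring

variable {T : ℝ≥0} {m : ℝ≥0 → FiniteMeasure (Euc d₁)}

lemma tendsto_left_of_eq_filterPath (hπ : IsConvSemigroup π) (hε : 0 < ε)
    (hm : ∀ t, t ≤ T → m t = filterPath π ρ h ε y t) {k : ℕ} (hk : obsTime ε (k + 1) ≤ T) :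
    Tendsto m (𝓝[<] obsTime ε (k + 1)) (𝓝 (propagate π (discreteFilter π ρ h ε y k) ε)) := by
  refine (tendsto_filterPath_obsTime hπ hε k).congr' ?_
  filter_upwards [self_mem_nhdsWithin] with s hs
  exact (hm s ((le_of_lt hs).trans hk)).symm

lemma neBot_nhdsLT_obsTime_succ (hε : 0 < ε) (k : ℕ) : (𝓝[<] obsTime ε (k + 1)).NeBot := by
  refine nhdsLT_neBot_of_exists_lt ⟨obsTime ε k, ?_⟩
  rw [obsTime_succ]
  exact lt_add_of_pos_right _ hε

/-- Positivity of ε makes the left neighbourhoods nontrivial; otherwise `Function.leftLim` would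
fall back to the value of m at the point. -/
lemma leftLim_eq_of_tendsto_obsTime (hε : 0 < ε) {k : ℕ} {l : FiniteMeasure (Euc d₁)}
    (hl : Tendsto m (𝓝[<] obsTime ε (k + 1)) (𝓝 l)) :
    Function.leftLim m (obsTime ε (k + 1)) = l :=
  have := neBot_nhdsLT_obsTime_succ hε k
  leftLim_eq_of_tendsto hl

/-- Induction on n: the interval up to the next observation contributes the integral of the
generator term, and the update contributes one more summand, taken against the left limit. -/
lemma filterPath_equation_obsTime (hX : IsIncrementLaw P₀ X π) (hg : HasGenerator P₀ X φ g)
    (hε : 0 < ε) (hm : ∀ t, t ≤ T → m t = filterPath π ρ h ε y t) (n : ℕ) (hn : obsTime ε n ≤ T) :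
    IntervalIntegrable (fun s : ℝ => ∫ x, g x ∂(m s.toNNReal : Measure (Euc d₁))) volume 0
      (obsTime ε n) ∧
    ∫ x, φ x ∂(discreteFilter π ρ h ε y n : Measure (Euc d₁)) = ∫ x, φ x ∂(ρ : Measure (Euc d₁)) +
      (∫ s in (0 : ℝ)..(obsTime ε n), ∫ x, g x ∂(m s.toNNReal : Measure (Euc d₁))) +
      ∑ k ∈ Finset.Icc 1 n, ∫ x, φ x * ((obsWeight h ε (y k) x - 1 : ℝ) : ℂ)
          ∂((Function.leftLim m (obsTime ε k) : FiniteMeasure (Euc d₁)) : Measure (Euc d₁)) := by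
  induction n with
  | zero => simp [obsTime, discreteFilter]
  | succ n ih =>
    obtain ⟨hi, he⟩ := ih ((obsTime_mono n.le_succ).trans hn)
    obtain ⟨hi', he'⟩ := hg.evolution hX (discreteFilter π ρ h ε y n)
      (obsTime_mono (ε := ε) n.le_succ) (m := m)
      fun s h1 h2 => by rw [hm s (h2.le.trans hn), filterPath_of_mem hε h1 h2]
    refine ⟨hi.trans hi', ?_⟩
    rw [Finset.sum_Icc_succ_top (by omega), ← intervalIntegral.integral_add_adjacent_intervals hi hi',
      leftLim_eq_of_tendsto_obsTime hε (tendsto_left_of_eq_filterPath hX.isConvSemigroup hε hm hn),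
      he', integral_discreteFilter_succ hg.bounded_left, he, obsTime_succ, add_tsub_cancel_left]
    ring

lemma filterPath_equation (hX : IsIncrementLaw P₀ X π) (hg : HasGenerator P₀ X φ g)
    (hε : 0 < ε) (hm : ∀ t, t ≤ T → m t = filterPath π ρ h ε y t) {t : ℝ≥0} (ht : t ≤ T) :
    IntervalIntegrable (fun s : ℝ => ∫ x, g x ∂(m s.toNNReal : Measure (Euc d₁))) volume 0 t ∧
    ∫ x, φ x ∂(m t : Measure (Euc d₁)) = ∫ x, φ x ∂(ρ : Measure (Euc d₁)) +
      (∫ s in (0 : ℝ)..t, ∫ x, g x ∂(m s.toNNReal : Measure (Euc d₁))) +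
      ∑ k ∈ Finset.Icc 1 ⌊t / ε⌋₊, ∫ x, φ x * ((obsWeight h ε (y k) x - 1 : ℝ) : ℂ)
          ∂((Function.leftLim m (obsTime ε k) : FiniteMeasure (Euc d₁)) : Measure (Euc d₁)) := by
  have hle := obsTime_floor_le hε t
  obtain ⟨hi, he⟩ := filterPath_equation_obsTime hX hg hε hm ⌊t / ε⌋₊ (hle.trans ht)
  obtain ⟨hi', he'⟩ := hg.evolution hX (discreteFilter π ρ h ε y ⌊t / ε⌋₊) hle (m := m)
      fun s h1 h2 => by
        rw [hm s (h2.le.trans ht), filterPath_of_mem hε h1 (h2.trans (lt_obsTime_floor_succ hε t))]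
  refine ⟨hi.trans hi', ?_⟩
  rw [← intervalIntegral.integral_add_adjacent_intervals hi hi', he', hm t ht, filterPath, he]
  ring

end Equation

/-! ### Uniqueness for the evolution equation -/

/-- A solution of the integral form of `f' = c f` is an exponential. -/
lemma eq_exp_mul_of_integral_equation {f : ℝ → ℂ} {c : ℂ} {a b : ℝ} (hab : a ≤ b)
    (hint : IntervalIntegrable (fun s => c * f s) volume a b)
    (heq : ∀ t ∈ Icc a b, f t = f a + ∫ s in a..t, c * f s) :
    f b = Complex.exp (c * (b - a)) * f a := by
  -- Only integrability is assumed. The equation itself makes f continuous, and then right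
  -- differentiable with derivative c f.
  have hF : ContinuousOn (fun t => ∫ s in a..t, c * f s) (Icc a b) := by
    have := intervalIntegral.continuousOn_primitive_interval (a := a) (b := b) (μ := volume)
      (f := fun s => c * f s) (by
        rw [uIcc_of_le hab]
        exact (intervalIntegrable_iff_integrableOn_Icc_of_le hab).1 hint)
    rwa [uIcc_of_le hab] at this
  have hf : ContinuousOn f (Icc a b) :=
    (continuousOn_const.add hF).congr fun t ht => heq t ht
  have hd : ∀ x ∈ Ico a b, HasDerivWithinAt f (c * f x) (Ici x) x := by
    intro x hx
    have hx' : x ∈ Icc a b := Ico_subset_Icc_self hx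
    have hcx : ContinuousWithinAt (fun s => c * f s) (Ici x) x := by
      have : ContinuousWithinAt (fun s => c * f s) (Icc x b) x :=
        (continuousOn_const.mul hf x hx').mono (Icc_subset_Icc_left hx.1)
      exact this.mono_of_mem_nhdsWithin (Icc_mem_nhdsGE hx.2)
    have hmeas : StronglyMeasurableAtFilter (fun s => c * f s) (𝓝[Ici x] x) volume :=
      ⟨Icc x b, Icc_mem_nhdsGE hx.2,
        ((continuousOn_const.mul hf).mono (Icc_subset_Icc_left hx.1)).aestronglyMeasurable
          measurableSet_Icc⟩
    have h1 : HasDerivWithinAt (fun t => ∫ s in a..t, c * f s) (c * f x) (Ici x) x := by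
      refine intervalIntegral.integral_hasDerivWithinAt_right (t := Ioi x) ?_ ?_ ?_
      · exact hint.mono_set (by
          rw [uIcc_of_le hx.1, uIcc_of_le hab]; exact Icc_subset_Icc_right hx.2.le)
      · obtain ⟨s, hs, hs'⟩ := hmeas
        exact ⟨s, nhdsWithin_mono _ Ioi_subset_Ici_self hs, hs'⟩
      · exact hcx.mono Ioi_subset_Ici_self
    have h2 := h1.const_add (f a)
    refine h2.congr_of_eventuallyEq ?_ (heq x hx')
    filter_upwards [Icc_mem_nhdsGE hx.2] with t ht
    exact heq t ⟨hx.1.trans ht.1, ht.2⟩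
  -- The integrating factor exp(-c(t - a)) gives a product with zero right derivative.
  have hu := constant_of_has_deriv_right_zero (a := a) (b := b)
    (f := fun t : ℝ => Complex.exp (-(c * (t - a))) * f t) (by fun_prop) (fun x hx => by
      have he : HasDerivWithinAt (fun t : ℝ => Complex.exp (-(c * (t - a))))
          (Complex.exp (-(c * (x - a))) * (-c)) (Ici x) x := by
        have h1 : HasDerivAt (fun t : ℝ => -(c * ((t : ℂ) - a))) (-c) x := by
          have := (((hasDerivAt_id x).ofReal_comp.sub_const (a : ℂ)).const_mul c).neg
          simpa [Pi.neg_def] using this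
        exact h1.cexp.hasDerivWithinAt
      have hz : Complex.exp (-(c * (x - a))) * (-c) * f x +
          Complex.exp (-(c * (x - a))) * (c * f x) = 0 := by ring
      exact hz ▸ he.mul (hd x hx)) b ⟨hab, le_rfl⟩
  simp only [sub_self, mul_zero, neg_zero, Complex.exp_zero, one_mul] at hu
  rw [← hu, ← mul_assoc, ← Complex.exp_add]
  simp

/-- The character `x ↦ exp (i θ'x)`. -/
def character {d : ℕ} (θ x : Euc d) : ℂ := Complex.exp (⟪x, θ⟫ * Complex.I)

lemma integral_character {d : ℕ} (θ : Euc d) (μ : Measure (Euc d)) :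
    ∫ x, character θ x ∂μ = charFun μ θ := rfl

lemma isBoundedMeasurable_character {d : ℕ} (θ : Euc d) : IsBoundedMeasurable (character θ) := by
  refine ⟨Continuous.measurable (by unfold character; fun_prop), 1, fun x => ?_⟩
  rw [character, Complex.norm_exp_ofReal_mul_I]

/-- Characteristic functions are continuous, so a dense set of frequencies determines the measure.
With a countable one, almost sure identities can be collected into one event. -/
lemma finiteMeasure_ext_of_charFun_dense {d : ℕ} {μ ν : FiniteMeasure (Euc d)} {D : Set (Euc d)}
    (hD : Dense D) (h : ∀ θ ∈ D, charFun (μ : Measure (Euc d)) θ = charFun (ν : Measure (Euc d)) θ) :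
    μ = ν := by
  have key : charFun (μ : Measure (Euc d)) = charFun (ν : Measure (Euc d)) := Continuous.ext_on hD continuous_charFun continuous_charFun h
  exact Subtype.ext (Measure.ext_of_charFun (E := Euc d) (μ := (μ : Measure (Euc d)))
    (ν := (ν : Measure (Euc d))) key)

section Uniqueness

variable {Ω : Type*} [MeasurableSpace Ω] {d₁ d₂ : ℕ} {P₀ : Measure Ω}
  {X : ℝ≥0 → Ω → Euc d₁} {π : ℝ≥0 → ProbabilityMeasure (Euc d₁)} {ρ : FiniteMeasure (Euc d₁)}
  {h : 𝓢(Euc d₁, Euc d₂)} {ε : ℝ≥0} {y : ℕ → Euc d₂} {ψ : Euc d₁ → ℂ}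
  {T : ℝ≥0} {m : ℝ≥0 → FiniteMeasure (Euc d₁)} {D : Set (Euc d₁)}

lemma charFun_propagate (hψ : ∀ t θ, charFun (π t : Measure (Euc d₁)) θ = Complex.exp (-t * ψ θ))
    (ρ : FiniteMeasure (Euc d₁)) (r : ℝ≥0) (θ : Euc d₁) :
    charFun (propagate π ρ r : Measure (Euc d₁)) θ =
      charFun (ρ : Measure (Euc d₁)) θ * Complex.exp (-r * ψ θ) := by
  rw [coe_propagate, charFun_conv, hψ]

/-- The evolution equation of a path of finite measures, tested with `φ`. -/
def EvolutionEquation (ρ : FiniteMeasure (Euc d₁)) (h : 𝓢(Euc d₁, Euc d₂)) (ε : ℝ≥0)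
    (y : ℕ → Euc d₂) (T : ℝ≥0) (m : ℝ≥0 → FiniteMeasure (Euc d₁)) (φ g : Euc d₁ → ℂ) : Prop :=
  ∀ t, t ≤ T →
    IntervalIntegrable (fun s : ℝ => ∫ x, g x ∂(m s.toNNReal : Measure (Euc d₁))) volume 0 t ∧
    ∫ x, φ x ∂(m t : Measure (Euc d₁)) = ∫ x, φ x ∂(ρ : Measure (Euc d₁)) +
      (∫ s in (0 : ℝ)..t, ∫ x, g x ∂(m s.toNNReal : Measure (Euc d₁))) +
      ∑ k ∈ Finset.Icc 1 ⌊t / ε⌋₊, ∫ x, φ x * ((obsWeight h ε (y k) x - 1 : ℝ) : ℂ)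
          ∂((Function.leftLim m (obsTime ε k) : FiniteMeasure (Euc d₁)) : Measure (Euc d₁))

/-- Times with the same floor see the same jump sum, which cancels in the difference. -/
lemma EvolutionEquation.sub {φ g : Euc d₁ → ℂ} (he : EvolutionEquation ρ h ε y T m φ g)
    {a t : ℝ≥0} (hat : a ≤ t) (ht : t ≤ T) (hfl : ⌊a / ε⌋₊ = ⌊t / ε⌋₊) :
    IntervalIntegrable (fun s : ℝ => ∫ x, g x ∂(m s.toNNReal : Measure (Euc d₁))) volume a t ∧
    ∫ x, φ x ∂(m t : Measure (Euc d₁)) = ∫ x, φ x ∂(m a : Measure (Euc d₁)) +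
      ∫ s in (a : ℝ)..t, ∫ x, g x ∂(m s.toNNReal : Measure (Euc d₁)) := by
  obtain ⟨hi, h1⟩ := he t ht
  obtain ⟨hi', h1'⟩ := he a (hat.trans ht)
  have hi2 := hi'.symm.trans hi
  refine ⟨hi2, ?_⟩
  rw [h1, h1', ← hfl, ← intervalIntegral.integral_add_adjacent_intervals hi' hi2]
  ring

/-- Since the test function is an eigenfunction, the equation closes on the characteristic function
and becomes scalar and linear on an interval without observations. -/
lemma EvolutionEquation.charFun_eq {θ : Euc d₁}
    (he : EvolutionEquation ρ h ε y T m (character θ) fun x => -ψ θ * character θ x)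
    {a t : ℝ≥0} (hat : a ≤ t) (ht : t ≤ T) (hfl : ⌊a / ε⌋₊ = ⌊t / ε⌋₊) :
    charFun (m t : Measure (Euc d₁)) θ =
      Complex.exp (-ψ θ * (t - a)) * charFun (m a : Measure (Euc d₁)) θ := by
  have key := eq_exp_mul_of_integral_equation (c := -ψ θ) (a := a) (b := t)
    (f := fun s : ℝ => charFun (m s.toNNReal : Measure (Euc d₁)) θ) (NNReal.coe_le_coe.2 hat) ?_ ?_
  · simpa using key
  · have := (he.sub hat ht hfl).1
    simpa only [integral_const_mul, integral_character] using this
  · intro s hs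
    have hs0 : 0 ≤ s := a.2.trans hs.1
    lift s to ℝ≥0 using hs0
    have hs1 : a ≤ s := NNReal.coe_le_coe.1 hs.1
    have hs2 : s ≤ t := NNReal.coe_le_coe.1 hs.2
    have hfl' : ⌊a / ε⌋₊ = ⌊s / ε⌋₊ := by
      refine le_antisymm (Nat.floor_mono (by gcongr)) (hfl ▸ Nat.floor_mono (by gcongr))
    have := (he.sub hs1 (hs2.trans ht) hfl').2
    simpa only [integral_const_mul, integral_character, Real.toNNReal_coe] using this

/-- The filter path is the only solution of the evolution equation. -/
theorem eq_filterPath_of_evolutionEquation (hX : IsIncrementLaw P₀ X π) (hε : 0 < ε)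
    (hψ : ∀ t θ, charFun (π t : Measure (Euc d₁)) θ = Complex.exp (-t * ψ θ))
    (hgen : ∀ θ, HasGenerator P₀ X (character θ) fun x => -ψ θ * character θ x)
    (hD : Dense D)
    (heq : ∀ θ ∈ D, EvolutionEquation ρ h ε y T m (character θ) fun x => -ψ θ * character θ x)
    {t : ℝ≥0} (ht : t ≤ T) : m t = filterPath π ρ h ε y t := by
  have hstep : ∀ n, obsTime ε n ≤ T → m (obsTime ε n) = discreteFilter π ρ h ε y n →
      ∀ t, t ≤ T → obsTime ε n ≤ t → t < obsTime ε (n + 1) →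
        m t = propagate π (discreteFilter π ρ h ε y n) (t - obsTime ε n) := by
    intro n hn hmn t ht h1 h2
    refine finiteMeasure_ext_of_charFun_dense hD fun θ hθ => ?_
    rw [(heq θ hθ).charFun_eq h1 ht (by rw [floor_obsTime hε, floor_eq_of_mem hε h1 h2]), hmn,
      charFun_propagate hψ, mul_comm]
    have : ((t - obsTime ε n : ℝ≥0) : ℂ) = (t : ℂ) - obsTime ε n := by
      rw [show ((t - obsTime ε n : ℝ≥0) : ℂ) = (((t - obsTime ε n : ℝ≥0) : ℝ) : ℂ) from rfl,
        NNReal.coe_sub h1]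
      push_cast; rfl
    rw [this]
    congr 2
    ring
  have hobs : ∀ n, obsTime ε n ≤ T → m (obsTime ε n) = discreteFilter π ρ h ε y n := by
    intro n
    induction n with
    | zero =>
      intro hn
      refine finiteMeasure_ext_of_charFun_dense hD fun θ hθ => ?_
      have := (heq θ hθ _ hn).2
      simpa [obsTime, integral_character, discreteFilter] using this
    | succ n ih =>
      intro hn
      have hn' := (obsTime_mono (ε := ε) n.le_succ).trans hn
      have hlt : obsTime ε n < obsTime ε (n + 1) := by
        rw [obsTime_succ]; exact lt_add_of_pos_right _ hε
      have hm := hstep n hn' (ih hn')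
      -- The values on the preceding interval are already identified, so the left limit entering the
      -- jump term is known.
      have hprop : Tendsto m (𝓝[<] obsTime ε (n + 1))
          (𝓝 (propagate π (discreteFilter π ρ h ε y n) ε)) := by
        refine (tendsto_filterPath_obsTime (ρ := ρ) (h := h) (y := y) hX.isConvSemigroup hε
          n).congr' ?_
        filter_upwards [self_mem_nhdsWithin, mem_nhdsWithin_of_mem_nhds (Ioi_mem_nhds hlt)]
          with s hs hs'
        rw [filterPath_of_mem hε (le_of_lt hs') hs]
        exact (hm s ((le_of_lt hs).trans hn) (le_of_lt hs') hs).symm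
      refine finiteMeasure_ext_of_charFun_dense hD fun θ hθ => ?_
      obtain ⟨hi', h1'⟩ := heq θ hθ _ hn'
      obtain ⟨hi, h1⟩ := heq θ hθ _ hn
      obtain ⟨hi2, h2⟩ := (hgen θ).evolution hX (discreteFilter π ρ h ε y n) hlt.le (m := m)
        fun s hs1 hs2 => hm s (hs2.le.trans hn) hs1 hs2
      rw [floor_obsTime hε, Finset.sum_Icc_succ_top (by omega),
        ← intervalIntegral.integral_add_adjacent_intervals hi' hi2, h2,
        leftLim_eq_of_tendsto_obsTime hε hprop, obsTime_succ, add_tsub_cancel_left,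
        ← obsTime_succ] at h1
      rw [floor_obsTime hε, ih hn'] at h1'
      rw [← integral_character, ← integral_character,
        integral_discreteFilter_succ (isBoundedMeasurable_character θ), h1]
      rw [h1']
      ring
  have hle := obsTime_floor_le hε t
  exact hstep _ (hle.trans ht) (hobs _ (hle.trans ht)) t ht hle (lt_obsTime_floor_succ hε t)

end Uniqueness

/-! ### The stable signal -/

section Stable

variable {Ω : Type*} [mΩ : MeasurableSpace Ω] {d : ℕ} {P₀ : Measure Ω}
  {α : ℝ} {Γ : Measure (Metric.sphere (0 : Euc d) 1)} {X : ℝ≥0 → Ω → Euc d}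

lemma IsLevyStable.measurable_sub (hX : IsLevyStable P₀ α Γ X) (s t : ℝ≥0) :
    Measurable fun ω => X t ω - X s ω := (hX.measurable t).sub (hX.measurable s)

variable [IsProbabilityMeasure P₀]

/-- The law of the increment of the signal over a time span `t`. -/
def IsLevyStable.incrementLaw (hX : IsLevyStable P₀ α Γ X) (t : ℝ≥0) : ProbabilityMeasure (Euc d) :=
  ⟨P₀.map fun ω => X t ω - X 0 ω,
    Measure.isProbabilityMeasure_map (hX.measurable_sub 0 t).aemeasurable⟩

lemma IsLevyStable.coe_incrementLaw (hX : IsLevyStable P₀ α Γ X) (t : ℝ≥0) :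
    (hX.incrementLaw t : Measure (Euc d)) = P₀.map fun ω => X t ω - X 0 ω := rfl

lemma IsLevyStable.charFun_map_sub (hX : IsLevyStable P₀ α Γ X) {s t : ℝ≥0} (hst : s ≤ t)
    (θ : Euc d) : charFun (P₀.map fun ω => X t ω - X s ω) θ =
      Complex.exp (-((t : ℂ) - s) * stableExponent α Γ θ) := by
  rcases eq_or_lt_of_le hst with rfl | hlt
  · simp
  · rw [← hX.charFun_increment s t hlt, charFun_apply, integral_map
      (hX.measurable_sub s t).aemeasurable
      (Continuous.aestronglyMeasurable (by fun_prop))]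
    refine integral_congr_ae (ae_of_all _ fun ω => ?_)
    simp only [real_inner_comm θ]
    rw [mul_comm]

lemma IsLevyStable.charFun_incrementLaw (hX : IsLevyStable P₀ α Γ X) (t : ℝ≥0) (θ : Euc d) :
    charFun (hX.incrementLaw t : Measure (Euc d)) θ = Complex.exp (-t * stableExponent α Γ θ) := by
  rw [coe_incrementLaw, hX.charFun_map_sub (zero_le)]
  simp

lemma IsLevyStable.map_sub (hX : IsLevyStable P₀ α Γ X) (s r : ℝ≥0) :
    P₀.map (fun ω => X (s + r) ω - X s ω) = hX.incrementLaw r := by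
  have := Measure.isProbabilityMeasure_map (μ := P₀) (hX.measurable_sub s (s + r)).aemeasurable
  apply Measure.ext_of_charFun
  ext θ
  rw [hX.charFun_map_sub (le_self_add), hX.charFun_incrementLaw]
  congr 2
  push_cast
  ring

/-- All of this is read off the characteristic functions exp(-tψ): convolution is multiplication,
and weak continuity is Lévy's continuity theorem. -/
lemma IsLevyStable.isConvSemigroup (hX : IsLevyStable P₀ α Γ X) :
    IsConvSemigroup hX.incrementLaw where
  zero := by
    rw [coe_incrementLaw]
    simp
  add s t := by
    apply Measure.ext_of_charFun
    ext θ
    rw [charFun_conv, hX.charFun_incrementLaw, hX.charFun_incrementLaw, hX.charFun_incrementLaw,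
      ← Complex.exp_add]
    congr 1
    push_cast
    ring
  continuous := by
    rw [continuous_iff_seqContinuous]
    intro u t hu
    refine ProbabilityMeasure.tendsto_of_tendsto_charFun fun θ => ?_
    simp only [Function.comp, hX.charFun_incrementLaw]
    have hc : Continuous fun t : ℝ≥0 => Complex.exp (-(t : ℂ) * stableExponent α Γ θ) := by
      have : Continuous fun t : ℝ≥0 => ((t : ℝ) : ℂ) :=
        Complex.continuous_ofReal.comp NNReal.continuous_coe
      exact Complex.continuous_exp.comp (this.neg.mul continuous_const)
    exact (hc.tendsto t).comp hu

lemma IsLevyStable.isIncrementLaw (hX : IsLevyStable P₀ α Γ X) :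
    IsIncrementLaw P₀ X hX.incrementLaw :=
  ⟨hX.measurable, fun _ => rfl, hX.isConvSemigroup⟩

/-- If t‖c‖ ≤ 1, use |e^z - 1| ≤ 2|z|; otherwise |e^z - 1| ≤ 2 ≤ 2t‖c‖. In the application the
hypothesis on the exponential is the bound 1 on a characteristic function. -/
lemma norm_inv_mul_exp_sub_one_le {c : ℂ} {t : ℝ} (ht : 0 < t) (h1 : ‖Complex.exp (-t * c)‖ ≤ 1) :
    ‖(t : ℂ)⁻¹ * (Complex.exp (-t * c) - 1)‖ ≤ 2 * ‖c‖ := by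
  rw [norm_mul, norm_inv, Complex.norm_real, Real.norm_of_nonneg ht.le, inv_mul_le_iff₀ ht]
  have hn : ‖-(t : ℂ) * c‖ = t * ‖c‖ := by
    rw [norm_mul, norm_neg, Complex.norm_real, Real.norm_of_nonneg ht.le]
  rcases le_total (t * ‖c‖) 1 with h | h
  · have := Complex.norm_exp_sub_one_le (x := -(t : ℂ) * c) (by rw [hn]; exact h)
    rw [hn] at this
    linarith
  · have := norm_sub_le (Complex.exp (-t * c)) 1
    rw [norm_one] at this
    linarith

lemma tendsto_inv_mul_exp_sub_one (c : ℂ) :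
    Tendsto (fun t : ℝ≥0 => (t : ℂ)⁻¹ * (Complex.exp (-t * c) - 1)) (𝓝[>] 0) (𝓝 (-c)) := by
  have hd : HasDerivAt (fun t : ℝ => Complex.exp (-t * c)) (-c) 0 := by
    have h1 : HasDerivAt (fun t : ℝ => -(t : ℂ) * c) (-1 * c) 0 :=
      ((hasDerivAt_id (0 : ℝ)).ofReal_comp.neg).mul_const c
    simpa using h1.cexp
  have h2 := hasDerivAt_iff_tendsto_slope_zero.1 hd
  have h3 : Tendsto (fun t : ℝ≥0 => (t : ℝ)) (𝓝[>] 0) (𝓝[≠] 0) := by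
    refine tendsto_nhdsWithin_iff.2 ⟨?_, ?_⟩
    · exact (NNReal.continuous_coe.tendsto' 0 0 rfl).mono_left nhdsWithin_le_nhds
    · filter_upwards [self_mem_nhdsWithin] with t ht
      exact (NNReal.coe_pos.2 ht).ne'
  refine (h2.comp h3).congr fun t => ?_
  simp only [Function.comp, zero_add, Complex.real_smul, Complex.ofReal_inv, Complex.ofReal_zero,
    neg_zero, zero_mul, Complex.exp_zero]

/-- Translation multiplies a character by a scalar, so characters are eigenfunctions of the
semigroup with eigenvalue exp(-tψ(θ)). They are the test functions of the uniqueness proof. -/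
lemma IsLevyStable.hasGenerator_character (hX : IsLevyStable P₀ α Γ X) (θ : Euc d) :
    HasGenerator P₀ X (character θ) fun x => -stableExponent α Γ θ * character θ x := by
  have hb := isBoundedMeasurable_character θ
  have hchar : ∀ x, ‖character θ x‖ = 1 := fun x => Complex.norm_exp_ofReal_mul_I _
  have hS : ∀ (t : ℝ≥0) x, semigroup P₀ X t (character θ) x =
      character θ x * Complex.exp (-t * stableExponent α Γ θ) := by
    intro t x
    rw [hX.isIncrementLaw.semigroup_eq t hb.1, ← hX.charFun_incrementLaw, ← integral_character,
      ← integral_const_mul]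
    refine integral_congr_ae (ae_of_all _ fun z => ?_)
    simp only [character]
    rw [← Complex.exp_add, inner_add_left]
    push_cast
    ring_nf
  have hq : ∀ (t : ℝ≥0) x, (t : ℂ)⁻¹ * (semigroup P₀ X t (character θ) x - character θ x) =
      (t : ℂ)⁻¹ * (Complex.exp (-t * stableExponent α Γ θ) - 1) * character θ x := by
    intro t x
    rw [hS]; ring
  refine ⟨hb, ⟨hb.1.const_mul _, ‖stableExponent α Γ θ‖, fun x => ?_⟩,
    ⟨2 * ‖stableExponent α Γ θ‖, fun t ht x => ?_⟩, fun x => ?_⟩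
  · rw [norm_mul, hchar, norm_neg, mul_one]
  · rw [hq, norm_mul, hchar, mul_one]
    refine norm_inv_mul_exp_sub_one_le (t := t) (NNReal.coe_pos.2 ht) ?_
    have := norm_charFun_le_one (μ := (hX.incrementLaw t : Measure (Euc d))) θ
    rwa [hX.charFun_incrementLaw] at this
  · simp only [hq]
    exact (tendsto_inv_mul_exp_sub_one _).mul_const _

end Stable

/-! ### The unnormalized filter as an expectation -/

section Independence

variable {Ω : Type*} [mΩ : MeasurableSpace Ω] {P : Measure Ω}

/-- The joint law factors as a triple product, and only the bracketing changes. This merges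
independence of the initial state with independence of the increments. -/
lemma indepFun_prodMk_of_indepFun {β γ δ : Type*} [MeasurableSpace β] [MeasurableSpace γ]
    [MeasurableSpace δ] [IsProbabilityMeasure P] {U : Ω → β} {A : Ω → γ} {Z : Ω → δ}
    (hU : Measurable U) (hA : Measurable A)
    (hZ : Measurable Z) (h1 : IndepFun U (fun ω => (A ω, Z ω)) P) (h2 : IndepFun A Z P) :
    IndepFun (fun ω => (U ω, A ω)) Z P := by
  have hUA : IndepFun U A P := h1.comp measurable_id measurable_fst
  have := Measure.isProbabilityMeasure_map (μ := P) hU.aemeasurable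
  have := Measure.isProbabilityMeasure_map (μ := P) hA.aemeasurable
  have := Measure.isProbabilityMeasure_map (μ := P) hZ.aemeasurable
  rw [indepFun_iff_map_prod_eq_prod_map_map (hU.prodMk hA).aemeasurable hZ.aemeasurable,
    hUA.map_prod_eq_prod_map_map hU.aemeasurable hA.aemeasurable]
  have e1 := h1.map_prod_eq_prod_map_map hU.aemeasurable (hA.prodMk hZ).aemeasurable
  rw [h2.map_prod_eq_prod_map_map hA.aemeasurable hZ.aemeasurable] at e1
  have e2 : (fun ω => ((U ω, A ω), Z ω)) =
      MeasurableEquiv.prodAssoc.symm ∘ fun ω => (U ω, (A ω, Z ω)) := rfl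
  rw [e2, ← Measure.map_map (MeasurableEquiv.measurable _) (hU.prodMk (hA.prodMk hZ)), e1,
    ← Measure.prodAssoc_prod]
  exact MeasurableEquiv.map_symm_map _

/-- Adding an independent variable to a weighted law amounts to a convolution. -/
lemma conv_map_withDensity_of_indepFun {β : Type*} [MeasurableSpace β] {d : ℕ}
    [IsProbabilityMeasure P] {U : Ω → β} {Z : Ω → Euc d} (hU : Measurable U) (hZ : Measurable Z)
    (hUZ : IndepFun U Z P) {w : β → ℝ≥0∞} (hw : Measurable w) {a : β → Euc d} (ha : Measurable a) :
    ((P.withDensity fun ω => w (U ω)).map fun ω => a (U ω)).conv (P.map Z) =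
      (P.withDensity fun ω => w (U ω)).map fun ω => a (U ω) + Z ω := by
  have := Measure.isProbabilityMeasure_map (μ := P) hU.aemeasurable
  have := Measure.isProbabilityMeasure_map (μ := P) hZ.aemeasurable
  refine Measure.ext_of_lintegral _ fun f hf => ?_
  have hfi : Measurable fun x => ∫⁻ z, f (x + z) ∂(P.map Z) :=
    Measurable.lintegral_prod_right' (f := fun p : Euc d × Euc d => f (p.1 + p.2)) (by fun_prop)
  have haU : Measurable fun ω => a (U ω) := ha.comp hU
  have hwU : Measurable fun ω => w (U ω) := hw.comp hU
  have hfU : Measurable fun ω => ∫⁻ z, f (a (U ω) + z) ∂(P.map Z) := hfi.comp haU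
  rw [Measure.lintegral_conv hf, lintegral_map hfi haU, lintegral_map hf (by fun_prop),
    lintegral_withDensity_eq_lintegral_mul _ hwU hfU,
    lintegral_withDensity_eq_lintegral_mul _ hwU (by fun_prop)]
  simp only [Pi.mul_apply]
  have hG : Measurable fun p : β × Euc d => w p.1 * f (a p.1 + p.2) := by fun_prop
  have e1 : ∫⁻ ω, w (U ω) * f (a (U ω) + Z ω) ∂P =
      ∫⁻ p, w p.1 * f (a p.1 + p.2) ∂((P.map U).prod (P.map Z)) := by
    rw [← hUZ.map_prod_eq_prod_map_map hU.aemeasurable hZ.aemeasurable,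
      lintegral_map hG (hU.prodMk hZ)]
  rw [e1, lintegral_prod _ hG.aemeasurable, lintegral_map hG.lintegral_prod_right' hU]
  refine lintegral_congr fun ω => ?_
  rw [← lintegral_const_mul _ (by fun_prop)]

end Independence

section Representation

variable {Ω : Type*} [mΩ : MeasurableSpace Ω] {d₁ d₂ : ℕ} {P₀ : Measure Ω} [IsProbabilityMeasure P₀]
  {α : ℝ} {Γ : Measure (Metric.sphere (0 : Euc d₁) 1)} {X : ℝ≥0 → Ω → Euc d₁}
  {h : 𝓢(Euc d₁, Euc d₂)} {ε : ℝ≥0}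

/-- The signal at the observation times up to the `n`-th is independent of its later increment. -/
lemma IsLevyStable.indepFun_past (hX : IsLevyStable P₀ α Γ X) (ε : ℝ≥0) (n : ℕ) (r : ℝ≥0) :
    IndepFun (fun ω (k : Finset.range (n + 1)) => X (obsTime ε k) ω)
      (fun ω => X (obsTime ε n + r) ω - X (obsTime ε n) ω) P₀ := by
  -- One monotone sequence whose n-th increment is the later one; it is constant after index n.
  let τ : ℕ → ℝ≥0 := fun k => if k ≤ n then obsTime ε k else obsTime ε n + r
  have hτ : Monotone τ := by
    intro i j hij
    simp only [τ]
    split_ifs with h1 h2 h2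
    · exact obsTime_mono hij
    · exact (obsTime_mono h1).trans le_self_add
    · omega
    · exact le_rfl
  have hind := hX.indep_increments.nat hτ
  have h2 := (hind.indepFun_finset (Finset.range n) {n} (by simp)
    fun i => hX.measurable_sub _ _).comp measurable_id
      (measurable_pi_apply (⟨n, by simp⟩ : ({n} : Finset ℕ)))
  simp only [Function.comp_def, id] at h2
  have hτn : τ n = obsTime ε n := by simp [τ]
  have hτn' : τ (n + 1) = obsTime ε n + r := by simp [τ]
  simp only [hτn, hτn'] at h2
  have hA : Measurable fun ω (i : Finset.range n) => X (τ (i + 1)) ω - X (τ i) ω :=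
    measurable_pi_lambda _ fun i => hX.measurable_sub _ _
  have h1 : IndepFun (X 0) (fun ω => ((fun (i : Finset.range n) => X (τ (i + 1)) ω - X (τ i) ω),
      X (obsTime ε n + r) ω - X (obsTime ε n) ω)) P₀ := by
    have hm : Measurable fun x : ℝ≥0 → Euc d₁ =>
        ((fun (i : Finset.range n) => x (τ (i + 1)) - x (τ i)),
          x (obsTime ε n + r) - x (obsTime ε n)) := by fun_prop
    have := hX.indep_initial.comp measurable_id hm
    simpa [Function.comp_def] using this
  have h3 := indepFun_prodMk_of_indepFun (hX.measurable 0) hA (hX.measurable_sub _ _) h1 h2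
  -- Rebuilds the signal at t_k from the initial state and the telescoping sum of the first k
  -- increments.
  let G : Euc d₁ × (Finset.range n → Euc d₁) → Finset.range (n + 1) → Euc d₁ :=
    fun p k => p.1 + ∑ i : Finset.range n, if (i : ℕ) < k then p.2 i else 0
  have hG : Measurable G := by
    refine measurable_pi_lambda _ fun k => measurable_fst.add ?_
    refine Finset.measurable_sum _ fun i _ => ?_
    split_ifs
    · fun_prop
    · exact measurable_const
  have h4 := h3.comp hG measurable_id
  refine (congrArg (fun F => IndepFun F _ P₀) ?_).mpr h4
  funext ω k
  obtain ⟨k, hk⟩ := k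
  simp only [Function.comp, G]
  rw [Finset.sum_coe_sort (Finset.range n)
    (fun i => if i < k then X (τ (i + 1)) ω - X (τ i) ω else 0), ← Finset.sum_filter]
  have hkn : k ≤ n := by simpa [Nat.lt_succ_iff] using hk
  have hfil : (Finset.range n).filter (· < k) = Finset.range k := by
    ext i; simp; omega
  rw [hfil, Finset.sum_range_sub (fun i => X (τ i) ω)]
  have : τ k = obsTime ε k := by simp [τ, hkn]
  have h0 : τ 0 = 0 := by simp [τ, obsTime]
  rw [this, h0]
  abel

end Representation

/-! ### The filter as a likelihood-weighted law of the signal -/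

section Likelihood

variable {Ω : Type*} [mΩ : MeasurableSpace Ω] {d₁ d₂ : ℕ} {P₀ : Measure Ω}
  {α : ℝ} {Γ : Measure (Metric.sphere (0 : Euc d₁) 1)} {X : ℝ≥0 → Ω → Euc d₁}
  {h : 𝓢(Euc d₁, Euc d₂)} {ε : ℝ≥0}

/-- The likelihood of the observation increments `y` up to the `n`-th along a signal path. -/
def likelihood (h : 𝓢(Euc d₁, Euc d₂)) (ε : ℝ≥0) (n : ℕ) (y : ℕ → Euc d₂) (x : ℝ≥0 → Euc d₁) : ℝ :=
  ∏ k ∈ Finset.Icc 1 n, obsWeight h ε (y k) (x (obsTime ε k))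

lemma likelihood_pos (n : ℕ) (y : ℕ → Euc d₂) (x : ℝ≥0 → Euc d₁) : 0 < likelihood h ε n y x :=
  Finset.prod_pos fun _ _ => obsWeight_pos _ _ _ _

lemma likelihood_def (n : ℕ) (y : ℕ → Euc d₂) (x : ℝ≥0 → Euc d₁) : likelihood h ε n y x =
    ∏ k ∈ Finset.Icc 1 n, obsWeight h ε (y k) (x (obsTime ε k)) := rfl

lemma likelihood_zero (y : ℕ → Euc d₂) (x : ℝ≥0 → Euc d₁) : likelihood h ε 0 y x = 1 := by
  simp [likelihood]

lemma likelihood_succ (n : ℕ) (y : ℕ → Euc d₂) (x : ℝ≥0 → Euc d₁) :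
    likelihood h ε (n + 1) y x =
      likelihood h ε n y x * obsWeight h ε (y (n + 1)) (x (obsTime ε (n + 1))) := by
  rw [likelihood, Finset.prod_Icc_succ_top (by omega), likelihood]

lemma measurable_likelihood_uncurry (n : ℕ) :
    Measurable fun p : (ℕ → Euc d₂) × (ℝ≥0 → Euc d₁) => likelihood h ε n p.1 p.2 := by
  unfold likelihood
  refine Finset.measurable_fun_prod _ fun k _ => ?_
  have hk : Measurable fun p : (ℕ → Euc d₂) × (ℝ≥0 → Euc d₁) => (p.1 k, p.2 (obsTime ε k)) := by
    fun_prop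
  exact (measurable_obsWeight_uncurry h ε).comp hk

lemma measurable_likelihood (n : ℕ) (y : ℕ → Euc d₂) :
    Measurable fun x : ℝ≥0 → Euc d₁ => likelihood h ε n y x :=
  (measurable_likelihood_uncurry n).comp (measurable_const.prodMk measurable_id)

attribute [irreducible] likelihood

lemma IsLevyStable.measurable_path (hX : IsLevyStable P₀ α Γ X) :
    Measurable fun ω (t : ℝ≥0) => X t ω := measurable_pi_lambda _ hX.measurable

/-- The law of the initial state. -/
def initialLaw (P₀ : Measure Ω) [IsFiniteMeasure P₀] (X : ℝ≥0 → Ω → Euc d₁) :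
    FiniteMeasure (Euc d₁) :=
  ⟨P₀.map (X 0), Measure.isFiniteMeasure_map _ _⟩

lemma coe_initialLaw [IsFiniteMeasure P₀] :
    (initialLaw P₀ X : Measure (Euc d₁)) = P₀.map (X 0) := rfl

variable [IsProbabilityMeasure P₀]

/-- The weight depends only on the signal at observation times up to t_n, which are independent of
the next increment; so weighting and adding that increment commute. -/
lemma IsLevyStable.propagate_eq_map_withDensity (hX : IsLevyStable P₀ α Γ X) (y : ℕ → Euc d₂)
    {n : ℕ} {ρ : FiniteMeasure (Euc d₁)}
    (hρ : (ρ : Measure (Euc d₁)) =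
      (P₀.withDensity fun ω => ENNReal.ofReal (likelihood h ε n y fun t => X t ω)).map
        (X (obsTime ε n))) (r : ℝ≥0) :
    (propagate hX.incrementLaw ρ r : Measure (Euc d₁)) =
      (P₀.withDensity fun ω => ENNReal.ofReal (likelihood h ε n y fun t => X t ω)).map
        (X (obsTime ε n + r)) := by
  have hU : Measurable fun ω (k : Finset.range (n + 1)) => X (obsTime ε k) ω :=
    measurable_pi_lambda _ fun k => hX.measurable _
  -- The likelihood as a function of finitely many states; index 0 gets factor 1, as nothing is
  -- observed at time 0.
  let w : (Finset.range (n + 1) → Euc d₁) → ℝ≥0∞ := fun u =>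
    ENNReal.ofReal (∏ k : Finset.range (n + 1),
      if (1 : ℕ) ≤ k then obsWeight h ε (y k) (u k) else 1)
  have hw : Measurable w := by
    refine (Finset.measurable_prod _ fun k _ => ?_).ennreal_ofReal
    split_ifs
    · exact (measurable_obsWeight h ε _).comp (measurable_pi_apply k)
    · exact measurable_const
  have hwe : ∀ ω, w (fun k => X (obsTime ε k) ω) =
      ENNReal.ofReal (likelihood h ε n y fun t => X t ω) := by
    intro ω
    simp only [w, likelihood_def]
    rw [Finset.prod_coe_sort (Finset.range (n + 1))
      (fun k => if 1 ≤ k then obsWeight h ε (y k) (X (obsTime ε k) ω) else 1),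
      ← Finset.prod_filter]
    have : (Finset.range (n + 1)).filter (1 ≤ ·) = Finset.Icc 1 n := by
      ext k; simp; omega
    rw [this]
  have key := conv_map_withDensity_of_indepFun hU (hX.measurable_sub _ _)
    (hX.indepFun_past ε n r) hw (a := fun u => u ⟨n, by simp⟩) (by fun_prop)
  simp only [hwe, add_sub_cancel] at key
  rw [coe_propagate, hρ, ← hX.map_sub (obsTime ε n) r]
  exact key

/-- The filter at the observation times is the law of the signal weighted by the likelihood of the
observations. -/
lemma IsLevyStable.discreteFilter_eq_map_withDensity (hX : IsLevyStable P₀ α Γ X) (y : ℕ → Euc d₂)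
    (n : ℕ) : (discreteFilter hX.incrementLaw (initialLaw P₀ X) h ε y n : Measure (Euc d₁)) =
      (P₀.withDensity fun ω => ENNReal.ofReal (likelihood h ε n y fun t => X t ω)).map
        (X (obsTime ε n)) := by
  induction n with
  | zero => simp [discreteFilter, likelihood_zero, obsTime, coe_initialLaw]
  | succ n ih =>
    have hm : ∀ n, Measurable fun ω => likelihood h ε n y fun t => X t ω := fun n =>
      (measurable_likelihood n y).comp hX.measurable_path
    rw [coe_discreteFilter_succ, hX.propagate_eq_map_withDensity y ih, ← obsTime_succ]
    have hwm : Measurable fun x => ENNReal.ofReal (obsWeight h ε (y (n + 1)) x) :=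
      (measurable_obsWeight h ε (y (n + 1))).ennreal_ofReal
    refine Measure.ext_of_lintegral _ fun f hf => ?_
    have hfX : Measurable fun ω => f (X (obsTime ε (n + 1)) ω) := hf.comp (hX.measurable _)
    have hwX : Measurable fun ω =>
        ENNReal.ofReal (obsWeight h ε (y (n + 1)) (X (obsTime ε (n + 1)) ω)) *
          f (X (obsTime ε (n + 1)) ω) := (hwm.comp (hX.measurable _)).mul hfX
    rw [lintegral_withDensity_eq_lintegral_mul _ hwm hf, lintegral_map (hwm.mul hf) (hX.measurable _),
      lintegral_map hf (hX.measurable _),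
      lintegral_withDensity_eq_lintegral_mul _ (hm (n + 1)).ennreal_ofReal hfX]
    simp only [Pi.mul_apply]
    rw [lintegral_withDensity_eq_lintegral_mul _ (hm n).ennreal_ofReal hwX]
    refine lintegral_congr fun ω => ?_
    simp only [Pi.mul_apply]
    rw [likelihood_succ, ENNReal.ofReal_mul (likelihood_pos _ _ _).le, mul_assoc]

lemma IsLevyStable.filterPath_eq_map_withDensity (hX : IsLevyStable P₀ α Γ X) (hε : 0 < ε)
    (y : ℕ → Euc d₂) (t : ℝ≥0) :
    (filterPath hX.incrementLaw (initialLaw P₀ X) h ε y t : Measure (Euc d₁)) =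
      (P₀.withDensity fun ω =>
        ENNReal.ofReal (likelihood h ε ⌊t / ε⌋₊ y fun t => X t ω)).map (X t) := by
  rw [filterPath, hX.propagate_eq_map_withDensity y (hX.discreteFilter_eq_map_withDensity y _),
    add_tsub_cancel_of_le (obsTime_floor_le hε t)]

lemma IsLevyStable.integral_filterPath (hX : IsLevyStable P₀ α Γ X) (hε : 0 < ε)
    (y : ℕ → Euc d₂) (t : ℝ≥0) {φ : Euc d₁ → ℂ} (hφ : Measurable φ) :
    ∫ x, φ x ∂(filterPath hX.incrementLaw (initialLaw P₀ X) h ε y t : Measure (Euc d₁)) =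
      ∫ x, φ (x t) * ((likelihood h ε ⌊t / ε⌋₊ y x : ℝ) : ℂ) ∂(P₀.map fun ω (t : ℝ≥0) => X t ω) := by
  have hm : Measurable fun ω => likelihood h ε ⌊t / ε⌋₊ y fun t => X t ω :=
    (measurable_likelihood _ y).comp hX.measurable_path
  have hm' : Measurable fun x : ℝ≥0 → Euc d₁ =>
      φ (x t) * ((likelihood h ε ⌊t / ε⌋₊ y x : ℝ) : ℂ) :=
    (hφ.comp (measurable_pi_apply t)).mul (Complex.measurable_ofReal.comp (measurable_likelihood _ y))
  rw [hX.filterPath_eq_map_withDensity hε, integral_map (hX.measurable t).aemeasurable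
    hφ.aestronglyMeasurable, integral_map hX.measurable_path.aemeasurable hm'.aestronglyMeasurable,
    integral_withDensity_eq_integral_toReal_smul hm.ennreal_ofReal
      (ae_of_all _ fun _ => ENNReal.ofReal_lt_top)]
  refine integral_congr_ae (ae_of_all _ fun ω => ?_)
  simp only [ENNReal.toReal_ofReal (likelihood_pos _ _ _).le, Complex.real_smul]
  exact mul_comm _ _

/-- The filter depends measurably on the observation increments. -/
lemma IsLevyStable.measurable_filterPath (hX : IsLevyStable P₀ α Γ X) (hε : 0 < ε) (t : ℝ≥0) :
    Measurable fun y : ℕ → Euc d₂ =>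
      (filterPath hX.incrementLaw (initialLaw P₀ X) h ε y t : Measure (Euc d₁)) := by
  refine Measure.measurable_of_measurable_coe _ fun s hs => ?_
  have hl : Measurable fun p : (ℕ → Euc d₂) × Ω =>
      ENNReal.ofReal (likelihood h ε ⌊t / ε⌋₊ p.1 fun t => X t p.2) :=
    ((measurable_likelihood_uncurry _).comp
      (measurable_fst.prodMk (hX.measurable_path.comp measurable_snd))).ennreal_ofReal
  have e : ∀ y : ℕ → Euc d₂,
      (filterPath hX.incrementLaw (initialLaw P₀ X) h ε y t : Measure (Euc d₁)) s =
      ∫⁻ ω in X t ⁻¹' s, ENNReal.ofReal (likelihood h ε ⌊t / ε⌋₊ y fun t => X t ω) ∂P₀ := by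
    intro y
    rw [hX.filterPath_eq_map_withDensity hε, Measure.map_apply (hX.measurable t) hs,
      withDensity_apply _ (hX.measurable t hs)]
  simp only [e]
  exact hl.lintegral_prod_right'

end Likelihood

/-! ### The change of measure -/

/-- Completing the square: -v²/(2ε) - av - εa²/2 = -(v + εa)²/(2ε). -/
lemma gaussianReal_withDensity_exp {ε : ℝ≥0} (hε : 0 < ε) (a : ℝ) :
    (gaussianReal 0 ε).withDensity (fun v => ENNReal.ofReal (Real.exp (-(a * v) - ε * a ^ 2 / 2))) =
      gaussianReal (-(ε * a)) ε := by
  rw [gaussianReal_of_var_ne_zero _ hε.ne', gaussianReal_of_var_ne_zero _ hε.ne',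
    ← withDensity_mul _ (measurable_gaussianPDF _ _) (by fun_prop)]
  congr 1
  funext v
  have hr : (ε : ℝ) ≠ 0 := NNReal.coe_ne_zero.2 hε.ne'
  simp only [Pi.mul_apply, gaussianPDF, gaussianPDFReal]
  rw [← ENNReal.ofReal_mul (by positivity), mul_assoc, ← Real.exp_add]
  congr 3
  field_simp
  ring

section Pi

variable {ι : Type*} [Fintype ι]

lemma lintegral_pi_prod (μ : ι → Measure ℝ) [∀ j, IsProbabilityMeasure (μ j)] {f : ι → ℝ → ℝ≥0∞}
    (hf : ∀ j, Measurable (f j)) :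
    ∫⁻ w, ∏ j, f j (w j) ∂(Measure.pi μ) = ∏ j, ∫⁻ v, f j v ∂(μ j) := by
  have hind : iIndepFun (fun j (w : ι → ℝ) => f j (w j)) (Measure.pi μ) :=
    iIndepFun_pi (X := f) fun j => (hf j).aemeasurable
  rw [lintegral_prod_eq_prod_lintegral_of_indepFun Finset.univ _ hind fun j =>
    (hf j).comp (measurable_pi_apply j)]
  refine Finset.prod_congr rfl fun j _ => ?_
  exact (measurePreserving_eval μ j).lintegral_comp (hf j)

lemma pi_withDensity_prod (μ : ι → Measure ℝ) [∀ j, IsProbabilityMeasure (μ j)]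
    {f : ι → ℝ → ℝ≥0∞} (hf : ∀ j, Measurable (f j))
    [∀ j, IsProbabilityMeasure ((μ j).withDensity (f j))] :
    (Measure.pi μ).withDensity (fun w => ∏ j, f j (w j)) =
      Measure.pi fun j => (μ j).withDensity (f j) := by
  refine (Measure.pi_eq fun s hs => ?_).symm
  have hi : ∀ w : ι → ℝ, (univ.pi s).indicator (fun w => ∏ j, f j (w j)) w =
      ∏ j, (s j).indicator (f j) (w j) := by
    intro w
    by_cases hw : w ∈ univ.pi s
    · rw [indicator_of_mem hw]
      exact Finset.prod_congr rfl fun j _ => (indicator_of_mem (hw j (mem_univ j)) _).symm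
    · rw [indicator_of_notMem hw]
      simp only [mem_univ_pi, not_forall] at hw
      obtain ⟨j, hj⟩ := hw
      exact (Finset.prod_eq_zero (Finset.mem_univ j) (indicator_of_notMem hj _)).symm
  rw [withDensity_apply _ (MeasurableSet.univ_pi hs), ← lintegral_indicator (.univ_pi hs)]
  simp only [hi]
  rw [lintegral_pi_prod μ fun j => (hf j).indicator (hs j)]
  refine Finset.prod_congr rfl fun j _ => ?_
  rw [lintegral_indicator (hs j), withDensity_apply _ (hs j)]

/-- The Cameron–Martin formula for a Gaussian vector with independent components. -/
lemma lintegral_gaussian_shift {ε : ℝ≥0} (hε : 0 < ε) (a : ι → ℝ) {F : (ι → ℝ) → ℝ≥0∞}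
    (hF : Measurable F) :
    ∫⁻ w, F (fun j => w j + ε * a j) *
      ∏ j, ENNReal.ofReal (Real.exp (-(a j * w j) - ε * a j ^ 2 / 2))
        ∂(Measure.pi fun _ : ι => gaussianReal 0 ε) =
      ∫⁻ w, F w ∂(Measure.pi fun _ : ι => gaussianReal 0 ε) := by
  let f : ι → ℝ → ℝ≥0∞ := fun j v => ENNReal.ofReal (Real.exp (-(a j * v) - ε * a j ^ 2 / 2))
  have hf : ∀ j, Measurable (f j) := fun j => by fun_prop
  have hd : ∀ j, (gaussianReal 0 ε).withDensity (f j) = gaussianReal (-(ε * a j)) ε :=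
    fun j => gaussianReal_withDensity_exp hε (a j)
  have : ∀ j, IsProbabilityMeasure ((gaussianReal 0 ε).withDensity (f j)) := fun j => by
    rw [hd]; infer_instance
  have h1 := pi_withDensity_prod (fun _ : ι => gaussianReal 0 ε) hf
  -- The density moves each mean to -εa_j, and the shift by εa_j brings it back to 0.
  have hmap : (Measure.pi fun j => (gaussianReal 0 ε).withDensity (f j)).map
      (fun w j => w j + ε * a j) = Measure.pi fun _ : ι => gaussianReal 0 ε := by
    have hp : ∀ j, IsProbabilityMeasure
        (((gaussianReal 0 ε).withDensity (f j)).map fun v => v + ε * a j) := fun j =>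
      Measure.isProbabilityMeasure_map (by fun_prop)
    rw [Measure.pi_map_pi (f := fun j v => v + ε * a j) fun j => by fun_prop]
    congr 1
    funext j
    rw [hd, gaussianReal_map_add_const, neg_add_cancel]
  conv_rhs => rw [← hmap, lintegral_map hF (by fun_prop), ← h1,
    lintegral_withDensity_eq_lintegral_mul _ (by fun_prop) (by fun_prop)]
  refine lintegral_congr fun w => ?_
  rw [Pi.mul_apply, mul_comm]

end Pi

section Noise

variable {Ω : Type*} {d₁ d₂ : ℕ}
  {X : ℝ≥0 → Ω → Euc d₁} {V : ℝ≥0 → Ω → Euc d₂} {h : 𝓢(Euc d₁, Euc d₂)} {ε : ℝ≥0}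

/-- The coordinates of the first `N` increments of `V` between observation times. -/
def noiseIncrement (ε : ℝ≥0) (N : ℕ) (v : ℝ≥0 → Euc d₂) (p : Fin d₂ × Fin N) : ℝ :=
  v (obsTime ε (p.2 + 1)) p.1 - v (obsTime ε p.2) p.1

lemma measurable_noiseIncrement (N : ℕ) :
    Measurable (noiseIncrement ε N : (ℝ≥0 → Euc d₂) → Fin d₂ × Fin N → ℝ) := by
  unfold noiseIncrement
  fun_prop

/-- The coordinates of the first `N` observation increments. -/
def obsIncrement (Y : ℕ → Ω → Euc d₂) (N : ℕ) (ω : Ω) (p : Fin d₂ × Fin N) : ℝ :=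
  (Y (p.2 + 1) ω - Y p.2 ω) p.1

/-- The sensor function along a signal path at the observation times. -/
def sensorPath (h : 𝓢(Euc d₁, Euc d₂)) (ε : ℝ≥0) (N : ℕ) (x : ℝ≥0 → Euc d₁) (p : Fin d₂ × Fin N) :
    ℝ :=
  h (x (obsTime ε (p.2 + 1))) p.1

lemma measurable_sensorPath (N : ℕ) : Measurable (sensorPath h ε N) := by
  refine measurable_pi_lambda _ fun p => ?_
  have h1 : Measurable fun z : Euc d₁ => h z p.1 := by
    have := h.continuous.measurable
    fun_prop
  exact h1.comp (measurable_pi_apply _)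

lemma obsIncrement_obs (N : ℕ) (ω : Ω) :
    obsIncrement (obs X V h ε) N ω = fun p => noiseIncrement ε N (fun t => V t ω) p +
      ε * sensorPath h ε N (fun t => X t ω) p := by
  funext p
  simp only [obsIncrement, obs, noiseIncrement, sensorPath, PiLp.sub_apply, PiLp.add_apply,
    PiLp.smul_apply, smul_eq_mul]
  ring

lemma density_eq_prod (T : ℝ≥0) (ω : Ω) :
    density X V h ε T ω = ∏ p : Fin d₂ × Fin ⌊T / ε⌋₊,
      Real.exp (-(sensorPath h ε _ (fun t => X t ω) p * noiseIncrement ε _ (fun t => V t ω) p) -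
        ε * sensorPath h ε _ (fun t => X t ω) p ^ 2 / 2) := by
  have hr : (Finset.Icc 1 ⌊T / ε⌋₊) = (Finset.range ⌊T / ε⌋₊).image (· + 1) := by
    ext k
    simp only [Finset.mem_Icc, Finset.mem_image, Finset.mem_range]
    exact ⟨fun hk => ⟨k - 1, by omega, by omega⟩, fun ⟨j, hj, hjk⟩ => by omega⟩
  rw [density, hr, Finset.prod_image (by intro a _ b _ hab; exact Nat.succ_injective hab),
    Fintype.prod_prod_type_right, Finset.prod_range]
  refine Finset.prod_congr rfl fun k _ => ?_
  rw [← Real.exp_sum]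
  congr 1
  rw [Finset.sum_sub_distrib, Finset.sum_neg_distrib, EuclideanSpace.norm_sq_eq, PiLp.inner_apply,
    Finset.sum_mul, Finset.sum_div]
  simp only [sensorPath, noiseIncrement, Real.norm_eq_abs, sq_abs, add_tsub_cancel_right]
  congr 1
  · congr 1
    refine Finset.sum_congr rfl fun i _ => ?_
    simp [mul_comm]
  · exact Finset.sum_congr rfl fun i _ => by ring

lemma density_pos (T : ℝ≥0) (ω : Ω) : 0 < density X V h ε T ω :=
  Finset.prod_pos fun _ _ => Real.exp_pos _

variable [mΩ : MeasurableSpace Ω] {P₀ : Measure Ω}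

lemma IsStandardBrownian.measurable_path (hV : IsStandardBrownian P₀ V) :
    Measurable fun ω (t : ℝ≥0) => V t ω := measurable_pi_lambda _ hV.measurable

lemma IsStandardBrownian.measurable_coord (hV : IsStandardBrownian P₀ V) (t : ℝ≥0) (i : Fin d₂) :
    Measurable fun ω => V t ω i := by
  have := hV.measurable t
  fun_prop

/-- Independence across coordinates, combined with independence of the increments within each
coordinate, makes the whole array independent; each entry has variance t_{k+1} - t_k = ε. -/
lemma IsStandardBrownian.map_noiseIncrement [IsProbabilityMeasure P₀]
    (hV : IsStandardBrownian P₀ V) (N : ℕ) :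
    P₀.map (fun ω => noiseIncrement ε N fun t => V t ω) =
      Measure.pi fun _ : Fin d₂ × Fin N => gaussianReal 0 ε := by
  have hm : ∀ (i : Fin d₂) (k : Fin N), Measurable fun ω =>
      V (obsTime ε (k + 1)) ω i - V (obsTime ε k) ω i := fun i k =>
    (hV.measurable_coord _ i).sub (hV.measurable_coord _ i)
  have h1 : iIndepFun (fun (i : Fin d₂) ω (k : Fin N) =>
      V (obsTime ε (k + 1)) ω i - V (obsTime ε k) ω i) P₀ :=
    hV.indep.comp (fun _ (b : ℝ≥0 → ℝ) (k : Fin N) => b (obsTime ε (k + 1)) - b (obsTime ε k))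
      fun _ => by fun_prop
  have h2 : ∀ i : Fin d₂, iIndepFun (fun (k : Fin N) ω =>
      V (obsTime ε (k + 1)) ω i - V (obsTime ε k) ω i) P₀ := fun i =>
    ((hV.coord i).hasIndepIncrements.nat (obsTime_mono (ε := ε))).precomp Fin.val_injective
  have h3 := iIndepFun_uncurry' hm h1 h2
  have h4 := (iIndepFun_iff_map_fun_eq_pi_map fun p : Fin d₂ × Fin N =>
    (hm p.1 p.2).aemeasurable).1 h3
  refine h4.trans ?_
  congr 1
  funext p
  have h5 := ((hV.coord p.1).hasLaw_sub (obsTime ε (p.2 + 1)) (obsTime ε p.2)).map_eq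
  have h6 : nndist ((obsTime ε (p.2 + 1) : ℝ≥0) : ℝ) ((obsTime ε p.2 : ℝ≥0) : ℝ) = ε := by
    apply NNReal.coe_injective
    rw [coe_nndist, Real.dist_eq, obsTime_succ, NNReal.coe_add, add_sub_cancel_left,
      NNReal.abs_eq]
  exact h5.trans (congrArg (gaussianReal 0) h6)

lemma measurable_density (hX : ∀ t, Measurable (X t)) (hV : ∀ t, Measurable (V t)) (T : ℝ≥0) :
    Measurable (density X V h ε T) := by
  unfold density
  refine Finset.measurable_fun_prod _ fun k _ => ?_
  have h1 : Measurable fun ω => h (X (obsTime ε k) ω) := h.continuous.measurable.comp (hX _)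
  have h2 := hV (obsTime ε k)
  have h3 := hV (obsTime ε (k - 1))
  fun_prop

/-- Under the reference measure the observation increments are Gaussian white noise independent of
the signal, which keeps its law. -/
theorem map_refMeasure [IsProbabilityMeasure P₀] (hX : ∀ t, Measurable (X t))
    (hV : IsStandardBrownian P₀ V)
    (hXV : IndepFun (fun ω (t : ℝ≥0) => X t ω) (fun ω (t : ℝ≥0) => V t ω) P₀)
    (hε : 0 < ε) (T : ℝ≥0) :
    (refMeasure P₀ X V h ε T).map
      (fun ω => ((fun t : ℝ≥0 => X t ω), obsIncrement (obs X V h ε) ⌊T / ε⌋₊ ω)) =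
      (P₀.map fun ω (t : ℝ≥0) => X t ω).prod
        (Measure.pi fun _ : Fin d₂ × Fin ⌊T / ε⌋₊ => gaussianReal 0 ε) := by
  set N := ⌊T / ε⌋₊
  have hXp : Measurable fun ω (t : ℝ≥0) => X t ω := measurable_pi_lambda _ hX
  have hW : Measurable fun ω => noiseIncrement ε N fun t => V t ω :=
    (measurable_noiseIncrement N).comp hV.measurable_path
  have hS : Measurable fun ω => sensorPath h ε N fun t => X t ω :=
    (measurable_sensorPath N).comp hXp
  have hind : IndepFun (fun ω (t : ℝ≥0) => X t ω) (fun ω => noiseIncrement ε N fun t => V t ω) P₀ :=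
    hXV.comp measurable_id (measurable_noiseIncrement N)
  have hlaw := hind.map_prod_eq_prod_map_map hXp.aemeasurable hW.aemeasurable
  rw [hV.map_noiseIncrement] at hlaw
  have := Measure.isProbabilityMeasure_map (μ := P₀) hXp.aemeasurable
  have hU : Measurable (obsIncrement (obs X V h ε) N) := by
    have : obsIncrement (obs X V h ε) N = fun ω p => noiseIncrement ε N (fun t => V t ω) p +
      ε * sensorPath h ε N (fun t => X t ω) p := funext fun ω => obsIncrement_obs N ω
    rw [this]
    fun_prop
  refine Measure.ext_of_lintegral _ fun F hF => ?_
  have hFU : Measurable fun ω => F ((fun t : ℝ≥0 => X t ω), obsIncrement (obs X V h ε) N ω) :=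
    hF.comp (hXp.prodMk hU)
  rw [lintegral_map hF (hXp.prodMk hU), refMeasure,
    lintegral_withDensity_eq_lintegral_mul _ (measurable_density hX hV.measurable T).ennreal_ofReal
      hFU, lintegral_prod _ hF.aemeasurable]
  -- The integrand as a function of the signal path and the noise, which are independent under P₀,
  -- so the noise can be integrated first.
  let G : (ℝ≥0 → Euc d₁) × (Fin d₂ × Fin N → ℝ) → ℝ≥0∞ := fun q =>
    F (q.1, fun p => q.2 p + ε * sensorPath h ε N q.1 p) *
      ∏ p, ENNReal.ofReal (Real.exp (-(sensorPath h ε N q.1 p * q.2 p) -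
        ε * sensorPath h ε N q.1 p ^ 2 / 2))
  have hG : Measurable G := by
    have hs : ∀ p, Measurable fun q : (ℝ≥0 → Euc d₁) × (Fin d₂ × Fin N → ℝ) =>
        sensorPath h ε N q.1 p := fun p =>
      (measurable_pi_apply p).comp ((measurable_sensorPath N).comp measurable_fst)
    refine Measurable.mul (hF.comp (measurable_fst.prodMk (measurable_pi_lambda _ fun p => ?_)))
      (Finset.measurable_fun_prod _ fun p _ => ?_)
    · have := hs p
      fun_prop
    · have := hs p
      fun_prop
  have e1 : ∀ ω, ((fun ω => ENNReal.ofReal (density X V h ε T ω)) *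
      fun ω => F ((fun t : ℝ≥0 => X t ω), obsIncrement (obs X V h ε) N ω)) ω =
      G ((fun t => X t ω), noiseIncrement ε N fun t => V t ω) := by
    intro ω
    simp only [Pi.mul_apply, G]
    rw [obsIncrement_obs, density_eq_prod,
      ENNReal.ofReal_prod_of_nonneg fun _ _ => (Real.exp_pos _).le, mul_comm]
  have e2 : ∫⁻ ω, G ((fun t => X t ω), noiseIncrement ε N fun t => V t ω) ∂P₀ =
      ∫⁻ q, G q ∂((P₀.map fun ω (t : ℝ≥0) => X t ω).prod
        (Measure.pi fun _ : Fin d₂ × Fin N => gaussianReal 0 ε)) := by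
    rw [← hlaw, lintegral_map hG (hXp.prodMk hW)]
  rw [lintegral_congr e1, e2, lintegral_prod _ hG.aemeasurable]
  refine lintegral_congr fun x => ?_
  exact lintegral_gaussian_shift hε (sensorPath h ε N x)
    (F := fun u => F (x, u)) (hF.comp measurable_prodMk_left)

end Noise

/-! ### The conditional expectation -/

section Product

variable {Ω β γ : Type*} [MeasurableSpace Ω] [MeasurableSpace β] [MeasurableSpace γ]
  {P : Measure Ω} {Λ : Measure β} {ν : Measure γ} [IsProbabilityMeasure Λ] [IsProbabilityMeasure ν]
  {A : Ω → β} {U : Ω → γ} {F : β × γ → ℂ}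

lemma map_snd_of_map_prod (hA : Measurable A) (hU : Measurable U)
    (hmap : P.map (fun ω => (A ω, U ω)) = Λ.prod ν) : P.map U = ν := by
  have : P.map U = (P.map fun ω => (A ω, U ω)).map Prod.snd := by
    rw [Measure.map_map measurable_snd (hA.prodMk hU)]; rfl
  rw [this, hmap, Measure.map_snd_prod, measure_univ, one_smul]

/-- Fubini: when A and U are independent, averaging over A alone gives the conditional expectation
given U. -/
lemma setIntegral_preimage_of_map_prod (hA : Measurable A) (hU : Measurable U)
    (hmap : P.map (fun ω => (A ω, U ω)) = Λ.prod ν) (hFm : Measurable F)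
    (hF : Integrable F (Λ.prod ν)) {B : Set γ} (hB : MeasurableSet B) :
    ∫ ω in U ⁻¹' B, F (A ω, U ω) ∂P = ∫ ω in U ⁻¹' B, ∫ x, F (x, U ω) ∂Λ ∂P := by
  have hGm : StronglyMeasurable fun u => ∫ x, F (x, u) ∂Λ :=
    (hFm.comp measurable_swap).stronglyMeasurable.integral_prod_right' (f := fun p : γ × β =>
      F (p.2, p.1))
  have h1 : ∫ ω in U ⁻¹' B, ∫ x, F (x, U ω) ∂Λ ∂P = ∫ u in B, ∫ x, F (x, u) ∂Λ ∂ν := by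
    rw [← map_snd_of_map_prod hA hU hmap,
      setIntegral_map hB hGm.aestronglyMeasurable hU.aemeasurable]
  have h2 : ∫ ω in U ⁻¹' B, F (A ω, U ω) ∂P = ∫ p in univ ×ˢ B, F p ∂(Λ.prod ν) := by
    rw [← hmap, setIntegral_map (MeasurableSet.univ.prod hB) hFm.aestronglyMeasurable
      (hA.prodMk hU).aemeasurable]
    congr 2
    ext ω; simp
  rw [h1, h2, ← Measure.prod_restrict, Measure.restrict_univ, integral_prod_symm]
  have : Λ.prod (ν.restrict B) = (Λ.prod ν).restrict (univ ×ˢ B) := by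
    rw [← Measure.prod_restrict, Measure.restrict_univ]
  rw [this]
  exact hF.restrict

lemma integrable_of_map_prod (hA : Measurable A) (hU : Measurable U)
    (hmap : P.map (fun ω => (A ω, U ω)) = Λ.prod ν) (hF : Integrable F (Λ.prod ν)) :
    Integrable (fun ω => F (A ω, U ω)) P ∧ Integrable (fun ω => ∫ x, F (x, U ω) ∂Λ) P := by
  constructor
  · rw [← hmap] at hF
    exact hF.comp_measurable (hA.prodMk hU)
  · have h1 := hF.integral_prod_right
    rw [← map_snd_of_map_prod hA hU hmap] at h1
    exact h1.comp_measurable hU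

end Product

section Increments

variable {Ω : Type*} {d₁ d₂ : ℕ}
  {X : ℝ≥0 → Ω → Euc d₁} {V : ℝ≥0 → Ω → Euc d₂} {h : 𝓢(Euc d₁, Euc d₂)} {ε : ℝ≥0}

/-- The sequence of increments of the observations. -/
def increments (Y : ℕ → Ω → Euc d₂) (ω : Ω) (k : ℕ) : Euc d₂ := Y k ω - Y (k - 1) ω

/-- The sequence of vectors with given coordinates, continued by zero. -/
def ofCoord (N : ℕ) (u : Fin d₂ × Fin N → ℝ) (k : ℕ) : Euc d₂ :=
  if hk : 1 ≤ k ∧ k ≤ N then WithLp.toLp 2 fun i => u (i, ⟨k - 1, by omega⟩) else 0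

lemma measurable_ofCoord (N : ℕ) :
    Measurable (ofCoord N : (Fin d₂ × Fin N → ℝ) → ℕ → Euc d₂) := by
  refine measurable_pi_lambda _ fun k => ?_
  unfold ofCoord
  split_ifs with hk
  · fun_prop
  · exact measurable_const

lemma ofCoord_obsIncrement (Y : ℕ → Ω → Euc d₂) (N : ℕ) (ω : Ω) {k : ℕ} (h1 : 1 ≤ k)
    (h2 : k ≤ N) : ofCoord N (obsIncrement Y N ω) k = increments Y ω k := by
  rw [ofCoord, dif_pos ⟨h1, h2⟩]
  ext i
  simp only [obsIncrement, increments, Nat.sub_add_cancel h1]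

lemma likelihood_congr {n : ℕ} {y y' : ℕ → Euc d₂} (hy : ∀ k, 1 ≤ k → k ≤ n → y k = y' k)
    (x : ℝ≥0 → Euc d₁) : likelihood h ε n y x = likelihood h ε n y' x := by
  rw [likelihood_def, likelihood_def]
  refine Finset.prod_congr rfl fun k hk => ?_
  rw [Finset.mem_Icc] at hk
  rw [hy k hk.1 hk.2]

/-- Substituting ΔV = ΔY - εh turns the exponent h'ΔV + εh'h/2 into h'ΔY - εh'h/2. -/
lemma inv_density_eq_likelihood (t : ℝ≥0) (ω : Ω) :
    (density X V h ε t ω)⁻¹ =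
      likelihood h ε ⌊t / ε⌋₊ (increments (obs X V h ε) ω) fun t => X t ω := by
  rw [density, likelihood_def, ← Finset.prod_inv_distrib]
  refine Finset.prod_congr rfl fun k hk => ?_
  obtain ⟨j, rfl⟩ : ∃ j, k = j + 1 := ⟨k - 1, by have := (Finset.mem_Icc.1 hk).1; omega⟩
  rw [← Real.exp_neg, obsWeight_def, increments]
  congr 1
  simp only [obs, add_tsub_cancel_right]
  generalize h (X (obsTime ε (j + 1)) ω) = z
  generalize V (obsTime ε (j + 1)) ω - V (obsTime ε j) ω = v
  have : obs X V h ε j ω + (ε : ℝ) • z + v - obs X V h ε j ω = (ε : ℝ) • z + v := by abel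
  rw [this, inner_add_left, real_inner_smul_left, real_inner_self_eq_norm_sq, real_inner_comm]
  ring

/-- The likelihood is itself a Cameron–Martin density, with drift minus the sensor path up to n and
zero afterwards, so its Gaussian integral is 1. -/
lemma likelihood_ofCoord {n N : ℕ} (hn : n ≤ N) (u : Fin d₂ × Fin N → ℝ) (x : ℝ≥0 → Euc d₁) :
    likelihood h ε n (ofCoord N u) x = ∏ p : Fin d₂ × Fin N,
      Real.exp (-((if (p.2 : ℕ) < n then -sensorPath h ε N x p else 0) * u p) -
        ε * (if (p.2 : ℕ) < n then -sensorPath h ε N x p else 0) ^ 2 / 2) := by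
  have hr : (Finset.Icc 1 n) = ((Finset.range N).filter (· < n)).image (· + 1) := by
    ext k
    simp only [Finset.mem_Icc, Finset.mem_image, Finset.mem_range, Finset.mem_filter]
    exact ⟨fun hk => ⟨k - 1, by omega, by omega⟩, fun ⟨j, hj, hjk⟩ => by omega⟩
  rw [likelihood_def, hr, Finset.prod_image (by intro a _ b _ hab; exact Nat.succ_injective hab),
    Finset.prod_filter, Fintype.prod_prod_type_right, Finset.prod_range]
  refine Finset.prod_congr rfl fun k _ => ?_
  split_ifs with hk
  · rw [← Real.exp_sum, obsWeight_def]
    congr 1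
    rw [Finset.sum_sub_distrib, EuclideanSpace.norm_sq_eq, PiLp.inner_apply,
      Finset.mul_sum, Finset.sum_div, ofCoord, dif_pos ⟨by omega, k.2⟩]
    simp only [sensorPath, Real.norm_eq_abs, sq_abs, add_tsub_cancel_right]
    congr 1
    · refine Finset.sum_congr rfl fun i _ => ?_
      simp [mul_comm]
    · exact Finset.sum_congr rfl fun i _ => by ring
  · simp

lemma integrable_likelihood_ofCoord {Λ : Measure (ℝ≥0 → Euc d₁)}
    [IsProbabilityMeasure Λ] (hε : 0 < ε) {n N : ℕ} (hn : n ≤ N) {φ : Euc d₁ → ℂ}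
    (hφ : IsBoundedMeasurable φ) (t : ℝ≥0) :
    Measurable (fun p : (ℝ≥0 → Euc d₁) × (Fin d₂ × Fin N → ℝ) =>
      φ (p.1 t) * ((likelihood h ε n (ofCoord N p.2) p.1 : ℝ) : ℂ)) ∧
    Integrable (fun p : (ℝ≥0 → Euc d₁) × (Fin d₂ × Fin N → ℝ) =>
      φ (p.1 t) * ((likelihood h ε n (ofCoord N p.2) p.1 : ℝ) : ℂ))
      (Λ.prod (Measure.pi fun _ => gaussianReal 0 ε)) := by
  obtain ⟨hm, C, hC⟩ := hφ
  have hL : Measurable fun p : (ℝ≥0 → Euc d₁) × (Fin d₂ × Fin N → ℝ) =>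
      likelihood h ε n (ofCoord N p.2) p.1 := by
    have h1 : Measurable fun p : (ℝ≥0 → Euc d₁) × (Fin d₂ × Fin N → ℝ) => (ofCoord N p.2, p.1) :=
      ((measurable_ofCoord N).comp measurable_snd).prodMk measurable_fst
    exact (measurable_likelihood_uncurry n).comp h1
  have hφm : Measurable fun p : (ℝ≥0 → Euc d₁) × (Fin d₂ × Fin N → ℝ) => φ (p.1 t) :=
    hm.comp ((measurable_pi_apply t).comp measurable_fst)
  have hint : Integrable (fun p : (ℝ≥0 → Euc d₁) × (Fin d₂ × Fin N → ℝ) =>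
      likelihood h ε n (ofCoord N p.2) p.1) (Λ.prod (Measure.pi fun _ => gaussianReal 0 ε)) := by
    refine ⟨hL.aestronglyMeasurable, ?_⟩
    rw [hasFiniteIntegral_iff_ofReal (ae_of_all _ fun p => (likelihood_pos _ _ _).le),
      lintegral_prod _ hL.ennreal_ofReal.aemeasurable]
    have h1 : ∀ x : ℝ≥0 → Euc d₁, ∫⁻ u : Fin d₂ × Fin N → ℝ,
        ENNReal.ofReal (likelihood h ε n (ofCoord N u) x)
          ∂(Measure.pi fun _ => gaussianReal 0 ε) = 1 := by
      intro x
      have := lintegral_gaussian_shift hε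
        (fun p : Fin d₂ × Fin N => if (p.2 : ℕ) < n then -sensorPath h ε N x p else 0)
        (F := fun _ => 1) measurable_const
      rw [lintegral_one, measure_univ] at this
      rw [← this]
      refine lintegral_congr fun u => ?_
      rw [likelihood_ofCoord hn, ENNReal.ofReal_prod_of_nonneg fun _ _ => (Real.exp_pos _).le,
        one_mul]
    simp only [h1, lintegral_one, measure_univ]
    exact ENNReal.one_lt_top
  refine ⟨hφm.mul (Complex.measurable_ofReal.comp hL), ?_⟩
  exact (hint.ofReal (𝕜 := ℂ)).bdd_mul hφm.aestronglyMeasurable (ae_of_all _ fun p => hC _)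

lemma measurable_comap_obsIncrement {Y : ℕ → Ω → Euc d₂} (h0 : Y 0 = fun _ => 0) {k N : ℕ} (hk : k ≤ N) :
    Measurable[MeasurableSpace.comap (obsIncrement Y N) inferInstance] (Y k) := by
  let _ : MeasurableSpace Ω := MeasurableSpace.comap (obsIncrement Y N) inferInstance
  have hU : Measurable (obsIncrement Y N) := comap_measurable _
  induction k with
  | zero => rw [h0]; exact measurable_const
  | succ k ih =>
    have h1 : Measurable fun ω => ofCoord N (obsIncrement Y N ω) (k + 1) :=
      (measurable_pi_apply (k + 1)).comp ((measurable_ofCoord N).comp hU)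
    have h2 : Y (k + 1) = fun ω => ofCoord N (obsIncrement Y N ω) (k + 1) + Y k ω := by
      funext ω
      rw [ofCoord_obsIncrement Y N ω (by omega) hk, increments, add_tsub_cancel_right,
        sub_add_cancel]
    rw [h2]
    exact h1.add (ih (by omega))

lemma measurable_increments_truncated {_ : MeasurableSpace Ω} {Y : ℕ → Ω → Euc d₂} {n : ℕ}
    (hY : ∀ k, k ≤ n → Measurable (Y k)) :
    Measurable fun ω k => if k ≤ n then increments Y ω k else 0 := by
  refine measurable_pi_lambda _ fun k => ?_
  split_ifs with hk
  · exact (hY k hk).sub (hY (k - 1) ((Nat.sub_le _ _).trans hk))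
  · exact measurable_const

end Increments

/-! ### The observation filtration and its null sets -/

section Filtration

variable {Ω : Type*} [mΩ : MeasurableSpace Ω] {d₂ : ℕ} {P₀ : Measure Ω} [P₀.IsComplete]
  {ε : ℝ≥0} {Y : ℕ → Ω → Euc d₂} {hY : ∀ k, Measurable (Y k)}

lemma measurable_obs_obsFiltration {k : ℕ} {t : ℝ≥0} (hk : obsTime ε k ≤ t) :
    Measurable[obsFiltration P₀ ε Y hY t] (Y k) := by
  rw [measurable_iff_comap_le]
  exact (le_iSup₂_of_le (f := fun (k : ℕ) (_ : obsTime ε k ≤ t) =>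
    MeasurableSpace.comap (Y k) inferInstance) k hk le_rfl).trans le_sup_left

lemma measurableSet_obsFiltration_of_null {t : ℝ≥0} {s : Set Ω} (hs : P₀ s = 0) :
    MeasurableSet[obsFiltration P₀ ε Y hY t] s := by
  have : MeasurableSpace.generateFrom {N : Set Ω | P₀ N = 0} ≤ obsFiltration P₀ ε Y hY t :=
    le_sup_right
  exact this s (MeasurableSpace.measurableSet_generateFrom hs)

/-- Up to null sets, the observation σ-algebra is generated by the observation increments. -/
lemma exists_preimage_ae_eq (hε : 0 < ε) (h0 : Y 0 = fun _ => 0) {t T : ℝ≥0} (htT : t ≤ T)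
    {s : Set Ω} (hs : MeasurableSet[obsFiltration P₀ ε Y hY t] s) :
    ∃ B : Set (Fin d₂ × Fin ⌊T / ε⌋₊ → ℝ), MeasurableSet B ∧
      s =ᵐ[P₀] obsIncrement Y ⌊T / ε⌋₊ ⁻¹' B := by
  -- Events equal, up to a null set, to an event of the increments form a σ-algebra containing both
  -- kinds of generators. Using increments up to T rather than t only enlarges it.
  have hle : obsFiltration P₀ ε Y hY t ≤ eventuallyMeasurableSpace
      (MeasurableSpace.comap (obsIncrement Y ⌊T / ε⌋₊) inferInstance) (ae P₀) := by
    refine sup_le (iSup₂_le fun k hk => ?_) (MeasurableSpace.generateFrom_le fun N hN => ?_)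
    · refine le_trans ?_ le_eventuallyMeasurableSpace
      rw [← measurable_iff_comap_le]
      exact measurable_comap_obsIncrement h0 ((obsTime_le_iff hε).1 (hk.trans htT))
    · refine ⟨∅, (MeasurableSpace.comap (obsIncrement Y ⌊T / ε⌋₊) inferInstance).measurableSet_empty, ?_⟩
      exact ae_eq_empty.2 hN
  obtain ⟨s', ⟨B, hB, rfl⟩, hss'⟩ := hle s hs
  exact ⟨B, hB, hss'⟩

lemma measurable_increments_obsFiltration (hε : 0 < ε) (t : ℝ≥0) :
    Measurable[obsFiltration P₀ ε Y hY t] fun ω k =>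
      if k ≤ ⌊t / ε⌋₊ then increments Y ω k else 0 :=
  measurable_increments_truncated fun _ hk =>
    measurable_obs_obsFiltration ((obsTime_le_iff hε).2 hk)

end Filtration

section CondExp

variable {Ω : Type*} [mΩ : MeasurableSpace Ω] {d₁ d₂ : ℕ} {P₀ : Measure Ω}
  {X : ℝ≥0 → Ω → Euc d₁} {V : ℝ≥0 → Ω → Euc d₂} {h : 𝓢(Euc d₁, Euc d₂)} {ε : ℝ≥0}
  {α : ℝ} {Γ : Measure (Metric.sphere (0 : Euc d₁) 1)}

lemma refMeasure_absolutelyContinuous (T : ℝ≥0) : refMeasure P₀ X V h ε T ≪ P₀ :=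
  withDensity_absolutelyContinuous _ _

/-- The density is strictly positive, so almost sure statements pass from P back to P₀. -/
lemma absolutelyContinuous_refMeasure (hX : ∀ t, Measurable (X t)) (hV : ∀ t, Measurable (V t))
    (T : ℝ≥0) : P₀ ≪ refMeasure P₀ X V h ε T :=
  withDensity_absolutelyContinuous' (measurable_density hX hV T).ennreal_ofReal.aemeasurable
    (ae_of_all _ fun ω => (ENNReal.ofReal_pos.2 (density_pos T ω)).ne')

variable [IsProbabilityMeasure P₀]

/-- The unnormalized filter along the observations. -/
def IsLevyStable.filter (hX : IsLevyStable P₀ α Γ X) (h : 𝓢(Euc d₁, Euc d₂)) (ε : ℝ≥0)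
    (Y : ℕ → Ω → Euc d₂) (t : ℝ≥0) (ω : Ω) : FiniteMeasure (Euc d₁) :=
  filterPath hX.incrementLaw (initialLaw P₀ X) h ε (increments Y ω) t

/-- The filter at time t uses only increments observed by then, whence its adaptedness. -/
lemma IsLevyStable.filter_eq_truncated (hX : IsLevyStable P₀ α Γ X) (Y : ℕ → Ω → Euc d₂)
    (t : ℝ≥0) (ω : Ω) : hX.filter h ε Y t ω = filterPath hX.incrementLaw (initialLaw P₀ X) h ε
      (fun k => if k ≤ ⌊t / ε⌋₊ then increments Y ω k else 0) t :=
  filterPath_congr fun _ _ hk => (if_pos hk).symm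

variable [P₀.IsComplete]

lemma IsLevyStable.measurable_filter (hX : IsLevyStable P₀ α Γ X) (hε : 0 < ε)
    {Y : ℕ → Ω → Euc d₂} (hY : ∀ k, Measurable (Y k)) (t : ℝ≥0) :
    Measurable[obsFiltration P₀ ε Y hY t] fun ω =>
      (hX.filter h ε Y t ω : Measure (Euc d₁)) := by
  simp only [hX.filter_eq_truncated]
  exact (hX.measurable_filterPath hε t).comp (measurable_increments_obsFiltration hε t)

lemma IsLevyStable.stronglyMeasurable_integral_filter (hX : IsLevyStable P₀ α Γ X) (hε : 0 < ε)
    {Y : ℕ → Ω → Euc d₂} (hY : ∀ k, Measurable (Y k)) (t : ℝ≥0) {φ : Euc d₁ → ℂ}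
    (hφ : Measurable φ) :
    StronglyMeasurable[obsFiltration P₀ ε Y hY t] fun ω =>
      ∫ x, φ x ∂(hX.filter h ε Y t ω : Measure (Euc d₁)) := by
  have := Measure.isProbabilityMeasure_map (μ := P₀) hX.measurable_path.aemeasurable
  simp only [hX.filter_eq_truncated, hX.integral_filterPath hε _ t hφ]
  have hm : Measurable fun p : (ℕ → Euc d₂) × (ℝ≥0 → Euc d₁) =>
      φ (p.2 t) * ((likelihood h ε ⌊t / ε⌋₊ p.1 p.2 : ℝ) : ℂ) :=
    (hφ.comp ((measurable_pi_apply t).comp measurable_snd)).mul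
      (Complex.measurable_ofReal.comp (measurable_likelihood_uncurry _))
  have h1 : StronglyMeasurable fun y : ℕ → Euc d₂ =>
      ∫ x, φ (x t) * ((likelihood h ε ⌊t / ε⌋₊ y x : ℝ) : ℂ)
        ∂(P₀.map fun ω (t : ℝ≥0) => X t ω) := hm.stronglyMeasurable.integral_prod_right'
  exact h1.comp_measurable (measurable_increments_obsFiltration hε t)

/-- The Kallianpur–Striebel formula: the filter is a version of the conditional expectation. -/
theorem IsLevyStable.integral_filter_ae_eq_condExp (hX : IsLevyStable P₀ α Γ X)
    (hV : IsStandardBrownian P₀ V)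
    (hXV : IndepFun (fun ω (t : ℝ≥0) => X t ω) (fun ω (t : ℝ≥0) => V t ω) P₀) (hε : 0 < ε)
    {t T : ℝ≥0} (htT : t ≤ T) {φ : Euc d₁ → ℂ} (hφ : IsBoundedMeasurable φ) :
    (fun ω => ∫ x, φ x ∂(hX.filter h ε (obs X V h ε) t ω : Measure (Euc d₁)))
      =ᵐ[refMeasure P₀ X V h ε T]
      (refMeasure P₀ X V h ε T)[fun ω => φ (X t ω) * (((density X V h ε t ω)⁻¹ : ℝ) : ℂ) |
        obsFiltration P₀ ε (obs X V h ε) (measurable_obs h ε hX.measurable hV.measurable) t] := by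
  have hY : ∀ k, Measurable (obs X V h ε k) := measurable_obs h ε hX.measurable hV.measurable
  set N := ⌊T / ε⌋₊
  have hn : ⌊t / ε⌋₊ ≤ N := Nat.floor_mono (by gcongr)
  have hΛ := Measure.isProbabilityMeasure_map (μ := P₀) hX.measurable_path.aemeasurable
  have hU : Measurable (obsIncrement (obs X V h ε) N) := by
    refine measurable_pi_lambda _ fun p => ?_
    have h1 := hY (p.2 + 1)
    have h2 := hY p.2
    unfold obsIncrement
    fun_prop
  have hA := hX.measurable_path
  have hmap := map_refMeasure (h := h) hX.measurable hV hXV hε T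
  have hPfin : IsFiniteMeasure (refMeasure P₀ X V h ε T) := by
    refine ⟨?_⟩
    have h1 := congrArg (fun m => m univ) hmap
    simp only [measure_univ] at h1
    rw [Measure.map_apply (hA.prodMk hU) MeasurableSet.univ, preimage_univ] at h1
    rw [h1]
    exact ENNReal.one_lt_top
  obtain ⟨hFm, hF⟩ := integrable_likelihood_ofCoord (h := h)
    (Λ := P₀.map fun ω (t : ℝ≥0) => X t ω) hε hn hφ t
  have hf : ∀ ω, φ (X t ω) * (((density X V h ε t ω)⁻¹ : ℝ) : ℂ) = φ (X t ω) *
      ((likelihood h ε ⌊t / ε⌋₊ (ofCoord N (obsIncrement (obs X V h ε) N ω)) (fun t => X t ω) : ℝ) : ℂ) := by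
    intro ω
    rw [inv_density_eq_likelihood, likelihood_congr (y := ofCoord N (obsIncrement (obs X V h ε) N ω))
      fun k h1 h2 => ofCoord_obsIncrement (obs X V h ε) N ω h1 (h2.trans hn)]
  have hg : ∀ ω, ∫ x, φ x ∂(hX.filter h ε (obs X V h ε) t ω : Measure (Euc d₁)) =
      ∫ x, φ (x t) * ((likelihood h ε ⌊t / ε⌋₊ (ofCoord N (obsIncrement (obs X V h ε) N ω)) x : ℝ) : ℂ)
        ∂(P₀.map fun ω (t : ℝ≥0) => X t ω) := by
    intro ω
    rw [← hX.integral_filterPath hε _ t hφ.1, IsLevyStable.filter,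
      filterPath_congr fun k h1 h2 => (ofCoord_obsIncrement (obs X V h ε) N ω h1 (h2.trans hn)).symm]
  obtain ⟨hi1, hi2⟩ := integrable_of_map_prod hA hU hmap hF
  refine ae_eq_condExp_of_forall_setIntegral_eq ((obsFiltration P₀ ε (obs X V h ε) hY).le t) ?_ ?_ ?_ ?_
  · simp only [hf]
    exact hi1
  · intro s _ _
    simp only [hg]
    exact hi2.integrableOn
  -- Up to a null set an event of 𝒴^t has the form {U ∈ B} for the increment array U, and there the
  -- identity is Fubini.
  · intro s hs _
    obtain ⟨B, hB, hsB⟩ := exists_preimage_ae_eq hε rfl htT hs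
    have hsB' : s =ᵐ[refMeasure P₀ X V h ε T] obsIncrement (obs X V h ε) N ⁻¹' B :=
      (refMeasure_absolutelyContinuous T).ae_eq hsB
    rw [setIntegral_congr_set hsB', setIntegral_congr_set hsB']
    simp only [hf, hg]
    exact (setIntegral_preimage_of_map_prod hA hU hmap hFm hF hB).symm
  · exact (hX.stronglyMeasurable_integral_filter hε hY t hφ.1).aestronglyMeasurable

end CondExp

/-! ### Progressive measurability -/

section Progressive

variable {Ω : Type*} [mΩ : MeasurableSpace Ω]

lemma isPiSystem_setOf_isClosed (E : Type*) [TopologicalSpace E] :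
    IsPiSystem {s : Set E | IsClosed s} := fun _ hs _ ht _ => hs.inter ht

/-- A family of finite measures is measurable if the integrals of bounded continuous functions
are. -/
lemma measurable_of_measurable_lintegral {S E : Type*} [MeasurableSpace S] [TopologicalSpace E]
    [HasOuterApproxClosed E] [MeasurableSpace E] [BorelSpace E] {u : S → FiniteMeasure E}
    (hu : ∀ f : BoundedContinuousFunction E ℝ≥0,
      Measurable fun s => ∫⁻ x, f x ∂(u s : Measure E)) :
    Measurable fun s => (u s : Measure E) := by
  -- Indicators of closed sets are limits of continuous functions, and closed sets form a π-system
  -- generating the Borel sets.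
  have hcl : ∀ F : Set E, IsClosed F → Measurable fun s => (u s : Measure E) F := by
    intro F hF
    refine measurable_of_tendsto_metrizable (fun n : ℕ => hu (hF.apprSeq n)) ?_
    rw [tendsto_pi_nhds]
    exact fun s => HasOuterApproxClosed.tendsto_lintegral_apprSeq hF _
  refine Measurable.measure_of_isPiSystem (S := {s : Set E | IsClosed s}) ?_
    (isPiSystem_setOf_isClosed E) hcl (hcl _ isClosed_univ)
  rw [BorelSpace.measurable_eq (α := E), borel_eq_generateFrom_isClosed]

/-- The least multiple of `1 / (n + 1)` that is at least `s`, capped at `i`. -/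
lemma tendsto_grid {i s : ℝ≥0} (hs : s ≤ i) :
    Tendsto (fun n : ℕ => min (((⌈s * ((n : ℝ≥0) + 1)⌉₊ : ℝ≥0)) / ((n : ℝ≥0) + 1)) i) atTop
      (𝓝[≥] s) := by
  refine tendsto_nhdsWithin_iff.2 ⟨?_, .of_forall fun n => ?_⟩
  · have h1 : Tendsto (fun n : ℕ => s + 1 / ((n : ℝ≥0) + 1)) atTop (𝓝 s) := by
      simpa using (tendsto_const_nhds (x := s)).add
        (tendsto_one_div_add_atTop_nhds_zero_nat (𝕜 := ℝ≥0))
    refine tendsto_of_tendsto_of_tendsto_of_le_of_le tendsto_const_nhds h1 (fun n => ?_) fun n => ?_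
    · refine le_min ?_ hs
      rw [le_div_iff₀ (by positivity)]
      exact Nat.le_ceil _
    · refine (min_le_left _ _).trans ?_
      rw [div_le_iff₀ (by positivity), add_mul, one_div, inv_mul_cancel₀ (by positivity)]
      exact (Nat.ceil_lt_add_one zero_le).le
  · refine le_min ?_ hs
    rw [le_div_iff₀ (by positivity)]
    exact Nat.le_ceil _

/-- An adapted right-continuous process of finite measures is progressive. -/
theorem isProgressive_of_rightContinuous {d : ℕ} {𝒴 : Filtration ℝ≥0 mΩ}
    {u : ℝ≥0 → Ω → FiniteMeasure (Euc d)}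
    (hc : ∀ ω t, ContinuousWithinAt (fun s => u s ω) (Ici t) t)
    (ha : ∀ t, Measurable[𝒴 t] fun ω => (u t ω : Measure (Euc d))) :
    IsProgressive 𝒴 fun t ω => (u t ω : Measure (Euc d)) := by
  intro i
  let _ : MeasurableSpace Ω := 𝒴 i
  refine measurable_of_measurable_lintegral
    (u := fun p : Iic i × Ω => u p.1 p.2) fun f => ?_
  -- Evaluate at grid times decreasing to the given time. Each approximation takes countably many
  -- times, and the cap at i keeps them within the information available at i.
  refine measurable_of_tendsto_metrizable (f := fun (n : ℕ) (p : Iic i × Ω) =>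
    ∫⁻ x, f x ∂(u (min (((⌈(p.1 : ℝ≥0) * ((n : ℝ≥0) + 1)⌉₊ : ℝ≥0)) / ((n : ℝ≥0) + 1)) i) p.2 :
      Measure (Euc d))) (fun n => ?_) ?_
  · have hG : Measurable fun q : ℕ × Ω =>
        ∫⁻ x, f x ∂(u (min ((q.1 : ℝ≥0) / ((n : ℝ≥0) + 1)) i) q.2 : Measure (Euc d)) := by
      refine measurable_from_prod_countable_right fun k => ?_
      have h1 : Measurable fun ω => (u (min ((k : ℝ≥0) / ((n : ℝ≥0) + 1)) i) ω : Measure (Euc d)) :=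
        (ha _).mono (𝒴.mono (min_le_right _ _)) le_rfl
      have hf : Measurable fun x => (f x : ℝ≥0∞) := f.continuous.measurable.coe_nnreal_ennreal
      exact (Measure.measurable_lintegral hf).comp h1
    have hq : Measurable fun p : Iic i × Ω => (⌈(p.1 : ℝ≥0) * ((n : ℝ≥0) + 1)⌉₊, p.2) := by
      refine Measurable.prodMk (Nat.measurable_ceil.comp ?_) measurable_snd
      exact (measurable_subtype_coe.comp measurable_fst).mul_const _
    have hGq := hG.comp hq
    simp only [Function.comp_def] at hGq
    exact hGq
  · rw [tendsto_pi_nhds]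
    intro p
    have h1 := (hc p.2 p.1).tendsto.comp (tendsto_grid p.1.2)
    exact FiniteMeasure.tendsto_iff_forall_lintegral_tendsto.1 h1 f

/-- The filtration contains every null set, so the preimages may be corrected by null sets. -/
lemma measurable_obsFiltration_of_ae_eq {S : Type*} [MeasurableSpace S] {d₂ : ℕ} {P₀ : Measure Ω}
    [P₀.IsComplete] {ε t : ℝ≥0} {Y : ℕ → Ω → Euc d₂} {hY : ∀ k, Measurable (Y k)} {f g : Ω → S}
    (hg : Measurable[obsFiltration P₀ ε Y hY t] g) (hfg : f =ᵐ[P₀] g) :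
    Measurable[obsFiltration P₀ ε Y hY t] f := by
  intro s hs
  have hnull : P₀ {ω | f ω ≠ g ω} = 0 := hfg
  have h1 : P₀ (g ⁻¹' s \ f ⁻¹' s) = 0 := measure_mono_null (t := {ω | f ω ≠ g ω})
    (fun ω hω (he : f ω = g ω) => hω.2 (by rw [mem_preimage, he]; exact hω.1)) hnull
  have h2 : P₀ (f ⁻¹' s \ g ⁻¹' s) = 0 := measure_mono_null (t := {ω | f ω ≠ g ω})
    (fun ω hω (he : f ω = g ω) => hω.2 (by rw [mem_preimage, ← he]; exact hω.1)) hnull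
  have h3 : f ⁻¹' s = (g ⁻¹' s \ (g ⁻¹' s \ f ⁻¹' s)) ∪ (f ⁻¹' s \ g ⁻¹' s) := by
    ext ω
    simp only [mem_union, Set.mem_sdiff, mem_preimage]
    tauto
  rw [h3]
  exact (MeasurableSet.diff (m := obsFiltration P₀ ε Y hY t) (hg hs)
    (measurableSet_obsFiltration_of_null h1)).union (measurableSet_obsFiltration_of_null h2)

end Progressive

/-! ### Comparison with arbitrary filters and solutions -/

section Main

variable {Ω : Type*} [mΩ : MeasurableSpace Ω] {d₁ d₂ : ℕ} {P₀ : Measure Ω}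
  {X : ℝ≥0 → Ω → Euc d₁} {V : ℝ≥0 → Ω → Euc d₂} {h : 𝓢(Euc d₁, Euc d₂)} {ε : ℝ≥0}
  {α : ℝ} {Γ : Measure (Metric.sphere (0 : Euc d₁) 1)}

/-- The unnormalized filter is unique up to indistinguishability. -/
theorem IsUnnormalizedFilter.ae_eq {𝒴 : Filtration ℝ≥0 mΩ} {T : ℝ≥0}
    {μ ν : ℝ≥0 → Ω → FiniteMeasure (Euc d₁)} (hX : ∀ t, Measurable (X t))
    (hV : ∀ t, Measurable (V t)) (hμ : IsUnnormalizedFilter P₀ X V h ε 𝒴 T μ)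
    (hν : IsUnnormalizedFilter P₀ X V h ε 𝒴 T ν) : ∀ᵐ ω ∂P₀, ∀ t, t ≤ T → μ t ω = ν t ω := by
  have h1 : ∀ t, t ≤ T → ∀ᵐ ω ∂P₀, μ t ω = ν t ω := by
    intro t ht
    -- Countably many characters identify the measure at a fixed time.
    have h2 : ∀ᵐ ω ∂P₀, ∀ n, charFun (μ t ω : Measure (Euc d₁)) (TopologicalSpace.denseSeq (Euc d₁) n) =
        charFun (ν t ω : Measure (Euc d₁)) (TopologicalSpace.denseSeq (Euc d₁) n) := by
      refine ae_all_iff.2 fun n => (absolutelyContinuous_refMeasure (h := h) (ε := ε) hX hV T).ae_eq ?_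
      exact (hμ.condExp t ht _ (isBoundedMeasurable_character _)).trans
        (hν.condExp t ht _ (isBoundedMeasurable_character _)).symm
    filter_upwards [h2] with ω hω
    refine finiteMeasure_ext_of_charFun_dense (TopologicalSpace.denseRange_denseSeq (Euc d₁)) ?_
    rintro _ ⟨n, rfl⟩
    exact hω n
  -- Countably many times, then right continuity, give equality at all times off one null set.
  have h3 : ∀ᵐ ω ∂P₀, ∀ n, freeze T μ (TopologicalSpace.denseSeq ℝ≥0 n) ω = freeze T ν (TopologicalSpace.denseSeq ℝ≥0 n) ω :=
    ae_all_iff.2 fun n => h1 _ (min_le_right _ _)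
  filter_upwards [h3] with ω hω t ht
  have h4 := (hμ.cadlag ω).eq_of_dense (hν.cadlag ω) (TopologicalSpace.denseRange_denseSeq ℝ≥0) (by
    rintro _ ⟨n, rfl⟩
    exact hω n)
  have h5 := congrFun h4 t
  simpa only [freeze, min_eq_left ht] using h5

variable [IsProbabilityMeasure P₀]

lemma IsLevyStable.satisfiesZakai_of_ae_eq (hX : IsLevyStable P₀ α Γ X) (hε : 0 < ε)
    {Y : ℕ → Ω → Euc d₂} {T : ℝ≥0} {μ : ℝ≥0 → Ω → FiniteMeasure (Euc d₁)}
    (hμ : ∀ᵐ ω ∂P₀, ∀ t, t ≤ T → μ t ω = hX.filter h ε Y t ω) :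
    SatisfiesZakai P₀ X h ε Y T μ where
  left_limits := by
    filter_upwards [hμ] with ω hω k hk hkT
    obtain ⟨j, rfl⟩ : ∃ j, k = j + 1 := ⟨k - 1, by omega⟩
    exact ⟨_, tendsto_left_of_eq_filterPath hX.isConvSemigroup hε hω hkT⟩
  equation φ g hg := by
    filter_upwards [hμ] with ω hω t ht
    have := filterPath_equation hX.isIncrementLaw hg hε (m := fun t => μ t ω) hω ht
    simpa only [obsWeight_def, increments, coe_initialLaw] using this

/-- The null set in the equation depends on the test function; restricting to countably many
characters leaves one null set, off which the deterministic uniqueness applies. -/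
lemma IsLevyStable.ae_eq_filter_of_satisfiesZakai (hX : IsLevyStable P₀ α Γ X) (hε : 0 < ε)
    {Y : ℕ → Ω → Euc d₂} {T : ℝ≥0} {ν : ℝ≥0 → Ω → FiniteMeasure (Euc d₁)}
    (hν : SatisfiesZakai P₀ X h ε Y T ν) :
    ∀ᵐ ω ∂P₀, ∀ t, t ≤ T → ν t ω = hX.filter h ε Y t ω := by
  have h1 : ∀ᵐ ω ∂P₀, ∀ n, EvolutionEquation (initialLaw P₀ X) h ε (increments Y ω) T
      (fun t => ν t ω) (character (TopologicalSpace.denseSeq (Euc d₁) n))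
      fun x => -stableExponent α Γ (TopologicalSpace.denseSeq (Euc d₁) n) * character (TopologicalSpace.denseSeq (Euc d₁) n) x := by
    refine ae_all_iff.2 fun n => ?_
    filter_upwards [hν.equation _ _ (hX.hasGenerator_character (TopologicalSpace.denseSeq (Euc d₁) n))] with ω hω t ht
    simpa only [obsWeight_def, increments, coe_initialLaw] using hω t ht
  filter_upwards [h1] with ω hω t ht
  refine eq_filterPath_of_evolutionEquation hX.isIncrementLaw hε hX.charFun_incrementLaw
    hX.hasGenerator_character (TopologicalSpace.denseRange_denseSeq (Euc d₁)) (m := fun t => ν t ω) ?_ ht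
  rintro _ ⟨n, rfl⟩
  exact hω n

variable [P₀.IsComplete]

theorem IsLevyStable.isUnnormalizedFilter_filter (hX : IsLevyStable P₀ α Γ X)
    (hV : IsStandardBrownian P₀ V)
    (hXV : IndepFun (fun ω (t : ℝ≥0) => X t ω) (fun ω (t : ℝ≥0) => V t ω) P₀) (hε : 0 < ε)
    (T : ℝ≥0) :
    IsUnnormalizedFilter P₀ X V h ε
      (obsFiltration P₀ ε (obs X V h ε) (measurable_obs h ε hX.measurable hV.measurable)) T
      (hX.filter h ε (obs X V h ε)) where
  cadlag _ := isCadlag_min (isCadlag_filterPath hX.isConvSemigroup hε) T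
  condExp _ ht _ hφ := hX.integral_filter_ae_eq_condExp hV hXV hε ht hφ

lemma IsLevyStable.isProgressiveUpTo_of_ae_eq (hX : IsLevyStable P₀ α Γ X) (hε : 0 < ε)
    {Y : ℕ → Ω → Euc d₂} (hY : ∀ k, Measurable (Y k)) {T : ℝ≥0}
    {μ : ℝ≥0 → Ω → FiniteMeasure (Euc d₁)} (hc : ∀ ω, IsCadlag fun t => freeze T μ t ω)
    (hμ : ∀ᵐ ω ∂P₀, ∀ t, t ≤ T → μ t ω = hX.filter h ε Y t ω) :
    IsProgressiveUpTo (obsFiltration P₀ ε Y hY) T μ := by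
  refine isProgressive_of_rightContinuous (fun ω t => (hc ω t).1) fun t => ?_
  refine measurable_obsFiltration_of_ae_eq
    (g := fun ω => (hX.filter h ε Y (min t T) ω : Measure (Euc d₁))) ?_ ?_
  · exact (hX.measurable_filter hε hY (min t T)).mono
      ((obsFiltration P₀ ε Y hY).mono (min_le_left _ _)) le_rfl
  · filter_upwards [hμ] with ω hω
    simp only [freeze]
    rw [hω _ (min_le_right _ _)]

end Main

end ContinuousDiscreteFilter

end

open ContinuousDiscreteFilter in
theorem lemma1 {Ω : Type*} [mΩ : MeasurableSpace Ω] {d₁ d₂ : ℕ}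
    (P₀ : Measure Ω) [IsProbabilityMeasure P₀] [P₀.IsComplete]
    (α : ℝ) (hα₀ : 0 < α) (hα₂ : α ≤ 2)
    (Γ : Measure (Metric.sphere (0 : Euc d₁) 1)) [IsFiniteMeasure Γ]
    (X : ℝ≥0 → Ω → Euc d₁) (hX : IsLevyStable P₀ α Γ X)
    (V : ℝ≥0 → Ω → Euc d₂) (hV : IsStandardBrownian P₀ V)
    (hXV : IndepFun (fun ω (t : ℝ≥0) => X t ω) (fun ω (t : ℝ≥0) => V t ω) P₀)
    (h : 𝓢(Euc d₁, Euc d₂)) (ε : ℝ≥0) (hε₀ : 0 < ε) (hε₁ : ε ≤ 1)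
    (Y : ℕ → Ω → Euc d₂) (hY : Y = obs X V h ε)
    (𝒴 : Filtration ℝ≥0 mΩ)
    (h𝒴 : 𝒴 = obsFiltration P₀ ε (obs X V h ε) (measurable_obs h ε hX.measurable hV.measurable)) :
    -- the unnormalized filter exists
    (∃ μ : ℝ≥0 → Ω → FiniteMeasure (Euc d₁),
      ∀ T : ℝ≥0, IsUnnormalizedFilter P₀ X V h ε 𝒴 T μ) ∧
    ∀ (T : ℝ≥0) (μ : ℝ≥0 → Ω → FiniteMeasure (Euc d₁)),
      IsUnnormalizedFilter P₀ X V h ε 𝒴 T μ →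
      -- it is progressive and satisfies the equation
      IsProgressiveUpTo 𝒴 T μ ∧ SatisfiesZakai P₀ X h ε Y T μ ∧
      -- and it is the only such process, up to indistinguishability
      ∀ ν : ℝ≥0 → Ω → FiniteMeasure (Euc d₁),
        IsProgressiveUpTo 𝒴 T ν → SatisfiesZakai P₀ X h ε Y T ν →
        ∀ᵐ ω ∂P₀, ∀ t, t ≤ T → ν t ω = μ t ω := by
  subst hY h𝒴
  refine ⟨⟨_, hX.isUnnormalizedFilter_filter hV hXV hε₀⟩, fun T μ hμ => ?_⟩
  have hae := hμ.ae_eq hX.measurable hV.measurable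
    (hX.isUnnormalizedFilter_filter hV hXV hε₀ T)
  refine ⟨hX.isProgressiveUpTo_of_ae_eq hε₀ _ hμ.cadlag hae, hX.satisfiesZakai_of_ae_eq hε₀ hae,
    fun ν _ hν => ?_⟩
  filter_upwards [hae, hX.ae_eq_filter_of_satisfiesZakai hε₀ hν] with ω h1 h2 t ht
  rw [h1 t ht, h2 t ht]
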